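/- Let $g\ge 0$ be an integer. There exist real constants $\nu_1',\nu_2'$, depending only on $g$, such that the following holds. Let $q_i(x,y)=a_ix^2+2b_ixy+c_iy^2$ $(i=1,\dots,g)$ be binary quadratic forms with $a_i,b_i,c_i\in\mathbb Z$, irreducible in $\mathbb Z[x,y]$, with $a_i\equiv 1\pmod 4$, and put $$D:=\prod_{p\le 2g}p\ \prod_{k=1}^g a_kc_k\delta_k\ \prod_{i<j}\operatorname{Res}(q_i,q_j),$$ where $p$ runs over primes, $\delta_k=4b_k^2-4a_kc_k$ is the discriminant of $q_k$ and $\operatorname{Res}$ is the resultant of two binary forms. Assume $D\ne 0$. Let $\mathbf z\in\mathbb Z^2$ be such that $\gcd(q_i(\mathbf z),D)=1$ for $i=1,\dots,g$, and let $\Psi:=\{\mathbf x\in\mathbb Z^2:\mathbf x\equiv\mathbf z \pmod D\}$. For a tuple $\mathbf d=(d_1,\dots,d_g)$ of positive integers put $$\Lambda^*_{\mathbf d}:=\{\mathbf x\in\mathbb Z^2: d_i\mid q_i(\mathbf x)\ (i=1,\dots,g),\ \gcd(x_1,x_2,d_1\cdots d_g)=1\},\qquad \rho^*(\mathbf d):=\#\bigl(\Lambda^*_{\mathbf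 d}\cap[0,d_1\cdots d_g)^2\bigr).$$ For real $M>0$ and $Q_1,\dots,Q_g\ge 1$ write $Q:=Q_1\cdots Q_g$ and $$T^*(M,\mathbf Q):=\sum_{\substack{1\le d_i\le Q_i\\ \gcd(d_i,D)=1\\ (i=1,\dots,g)}}\ \sup_{\partial(\mathcal R)\le M}\left|\#(\Lambda^*_{\mathbf d}\cap\mathcal R\cap\Psi)-\frac{\rho^*(\mathbf d)}{(d_1\cdots d_gD)^2}\operatorname{vol}(\mathcal R)\right|,$$ where $\mathcal R$ ranges over the bounded convex subsets of $\mathbb R^2$ whose boundary has length (one-dimensional Hausdorff measure) $\partial(\mathcal R)\le M$. Then $$T^*(M,\mathbf Q)\ll M\sqrt Q\,(\log 2Q)^{\nu_1'}+Q\,(\log 2Q)^{\nu_2'}$$ uniformly in $M>0$ and $Q_1,\dots,Q_g\ge 1$, with an implied constant depending only on the forms $q_1,\dots,q_g$. -/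

import Mathlib

open scoped MeasureTheory

/-- The binary quadratic form `a x² + 2 b x y + c y²` with integers `a`, `b`, `c`. -/
structure BinForm where
  a : ℤ
  b : ℤ
  c : ℤ

namespace BinForm

/-- The form as a polynomial in `ℤ[x, y]`. -/
noncomputable def toPoly (q : BinForm) : MvPolynomial (Fin 2) ℤ :=
  MvPolynomial.C q.a * MvPolynomial.X 0 ^ 2
    + MvPolynomial.C (2 * q.b) * MvPolynomial.X 0 * MvPolynomial.X 1
    + MvPolynomial.C q.c * MvPolynomial.X 1 ^ 2

/-- The value of the form at an integer point. -/
def eval (q : BinForm) (x : ℤ × ℤ) : ℤ :=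
  q.a * x.1 ^ 2 + 2 * q.b * x.1 * x.2 + q.c * x.2 ^ 2

/-- The discriminant `(2b)² - 4ac` of the form. -/
def disc (q : BinForm) : ℤ := discrim q.a (2 * q.b) q.c

/-- The dehomogenised form `q(Y, 1)`. -/
noncomputable def dehom (q : BinForm) : Polynomial ℤ :=
  Polynomial.C q.a * Polynomial.X ^ 2 + Polynomial.C (2 * q.b) * Polynomial.X
    + Polynomial.C q.c

/-- The resultant of two binary quadratic forms: the determinant of the `4 × 4` Sylvester matrix. -/
noncomputable def res (q r : BinForm) : ℤ :=
  Polynomial.resultant q.dehom r.dehom 2 2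

end BinForm

namespace LevelDist

/-- `D = ∏_{p ≤ 2g} p · ∏_k a_k c_k δ_k · ∏_{i<j} Res(q_i, q_j)`. -/
noncomputable def bigD {g : ℕ} (q : Fin g → BinForm) : ℤ :=
  (primorial (2 * g) : ℤ) * (∏ k, (q k).a * (q k).c * (q k).disc)
    * ∏ i, ∏ j ∈ Finset.Ioi i, (q i).res (q j)

/-- `Λ*_d`: the integer points `x` with `d_i ∣ q_i(x)` for all `i` and
`gcd(x₁, x₂, d₁ ⋯ d_g) = 1`. -/
def lamStar {g : ℕ} (q : Fin g → BinForm) (d : Fin g → ℕ) : Set (ℤ × ℤ) :=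
  {x | (∀ i, (d i : ℤ) ∣ (q i).eval x) ∧ Nat.gcd (Int.gcd x.1 x.2) (∏ i, d i) = 1}

/-- `ρ*(d) = #(Λ*_d ∩ [0, d₁ ⋯ d_g)²)`. -/
noncomputable def rhoStar {g : ℕ} (q : Fin g → BinForm) (d : Fin g → ℕ) : ℕ :=
  (lamStar q d ∩
    (Set.Ico 0 ((∏ i, d i : ℕ) : ℤ) ×ˢ Set.Ico 0 ((∏ i, d i : ℕ) : ℤ))).ncard

/-- `Ψ`: the integer points congruent to `z` modulo `D`. -/
def psiSet (D : ℤ) (z : ℤ × ℤ) : Set (ℤ × ℤ) :=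
  {x | x.1 ≡ z.1 [ZMOD D] ∧ x.2 ≡ z.2 [ZMOD D]}

/-- An integer point, viewed in the Euclidean plane. -/
noncomputable def toPlane (x : ℤ × ℤ) : EuclideanSpace ℝ (Fin 2) :=
  !₂[(x.1 : ℝ), (x.2 : ℝ)]

/-- The regions `R` with `∂(R) ≤ M`: bounded convex subsets of the plane whose boundary has length
(one-dimensional Hausdorff measure) at most `M`. -/
def regions (M : ℝ) : Set (Set (EuclideanSpace ℝ (Fin 2))) :=
  {R | Convex ℝ R ∧ Bornology.IsBounded R ∧ μH[(1 : ℝ)] (frontier R) ≤ ENNReal.ofReal M}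

/-- `|#(Λ*_d ∩ R ∩ Ψ) - ρ*(d) vol(R) / (d₁ ⋯ d_g D)²|`. The set counted is finite, and the volume is
finite, whenever `R` is bounded. -/
noncomputable def discrepancyStar {g : ℕ} (q : Fin g → BinForm) (z : ℤ × ℤ) (d : Fin g → ℕ)
    (R : Set (EuclideanSpace ℝ (Fin 2))) : ℝ :=
  |((lamStar q d ∩ toPlane ⁻¹' R ∩ psiSet (bigD q) z).ncard : ℝ)
    - (rhoStar q d : ℝ) / (((∏ i, d i : ℕ) : ℝ) * (bigD q : ℝ)) ^ 2
      * (MeasureTheory.volume R).toReal|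

/-- The tuples of positive integers `d` with `d_i ≤ Q_i` and `gcd(d_i, D) = 1` for all `i`. -/
noncomputable def moduli {g : ℕ} (D : ℤ) (Q : Fin g → ℝ) : Finset (Fin g → ℕ) :=
  (Fintype.piFinset fun i => Finset.Icc 1 ⌊Q i⌋₊).filter fun d => ∀ i, Int.gcd (d i) D = 1

/-- `T*(M, Q)`, as an element of `[0, ∞]`, so that the suprema are genuine. -/
noncomputable def TStar {g : ℕ} (q : Fin g → BinForm) (z : ℤ × ℤ) (M : ℝ) (Q : Fin g → ℝ) :
    ENNReal :=
  ∑ d ∈ moduli (bigD q) Q, ⨆ R ∈ regions M, ENNReal.ofReal (discrepancyStar q z d R)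

end LevelDist

/-! Write n = d₁⋯d_g, and let τ be the divisor function. Since d is prime to every a_i, a point of
Λ*_d has x₂ invertible mod n. So it lies on exactly one line x₁ ≡ A x₂ (mod n), where A is a common
root of q_i(A, 1) ≡ 0 (mod d_i). Möbius inversion removes the condition gcd(x₂, n) = 1 and turns the
indicator of Λ*_d into a signed sum, over roots A and divisors e of n, of indicators of the lattices
n ∣ x₁ - A x₂, e ∣ x₂ (`indicator_lamStar`). The same expansion computes ρ*(d), so the main terms
cancel exactly and only lattice point errors remain.

The boundary length of a convex region bounds its widths. With a Gauss-reduced basis, each lattice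
error is then at most 8M/|v| + 1, with v a shortest nonzero vector of the lattice of (n, A) and |v|
its sup norm (`abs_ncard_congruence_sub_le`, `discrepancyStar_le`). There are at most ∏ τ(d_i) roots
A (`card_rootSet_le`), so the terms 1 add up to Q times a power of the logarithm.

For the terms 8M/|v| the summation is turned around. The vector v satisfies |v|² ≤ 2n ≤ 2Q and d_i ∣
q_i(v), and q_i(v) ≠ 0 by irreducibility. Let W(v) count the tuples of divisors of the q_i(v) prime
to D. For fixed v, the choice of d, the choice of A and the factor τ(n) cost at most W(v) each
(`sum_shortVec_le`). It remains to show that the sum of W(v)³/|v| over 0 < |v| ≤ X is X times a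
power of log X; taking X ≍ √Q produces the factor √Q.

The values q_i(v) are of size X², too large to open all their divisors. However, τ(n) is controlled
by a divisor of n that is at most a small power of n (`exists_small_divisor`). With the size of
these divisors chosen so that a product of g of them is O(X), primitive vectors w with b_i ∣ q_i(w)
are counted trivially, and moments of τ finish (`sum_divisorWeight_primitive_le`). Dyadic summation
and extraction of gcd(v₁, v₂) give the weighted sum over all nonzero v
(`sum_divisorWeight_div_height_le`). -/

namespace LevelDist
open MeasureTheory Set

/-! ### Integer points in planar convex sets. -/

/-- A bounded convex set of reals contains as many integers as its length, up to one. -/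
lemma volume_count_intCast_preimage {I : Set ℝ} (hI : Convex ℝ I) (hb : Bornology.IsBounded I) :
    volume I ≤ Measure.count ((fun n : ℤ => (n : ℝ)) ⁻¹' I) + 1 ∧
      Measure.count ((fun n : ℤ => (n : ℝ)) ⁻¹' I) ≤ volume I + 1 := by
  rcases I.eq_empty_or_nonempty with rfl | hne
  · simp
  have hba := hb.bddAbove
  have hbb := hb.bddBelow
  set α := sInf I
  set β := sSup I
  have hsub : I ⊆ Icc α β := fun x hx => ⟨csInf_le hbb hx, le_csSup hba hx⟩
  have hαβ : α ≤ β := by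
    obtain ⟨x, hx⟩ := hne
    exact (hsub hx).1.trans (hsub hx).2
  have hsup : Ioo α β ⊆ I := by
    intro x hx
    obtain ⟨a, ha, hax⟩ := exists_lt_of_csInf_lt hne hx.1
    obtain ⟨b, hb, hxb⟩ := exists_lt_of_lt_csSup hne hx.2
    exact hI.ordConnected.out ha hb ⟨hax.le, hxb.le⟩
  have hvol : volume I = ENNReal.ofReal (β - α) :=
    le_antisymm ((measure_mono hsub).trans_eq Real.volume_Icc)
      (Real.volume_Ioo.symm.trans_le (measure_mono hsup))
  have h0 : 0 ≤ β - α := sub_nonneg.2 hαβ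
  rw [hvol]
  constructor
  · have h1 : Measure.count ((fun n : ℤ => (n : ℝ)) ⁻¹' Ioo α β)
        ≤ Measure.count ((fun n : ℤ => (n : ℝ)) ⁻¹' I) := measure_mono (preimage_mono hsup)
    rw [Int.preimage_Ioo, ← Finset.coe_Ioo, Measure.count_apply_finset, Int.card_Ioo] at h1
    refine le_trans ?_ (add_le_add_left h1 1)
    have h2 : β - α ≤ ((⌈β⌉ - ⌊α⌋ - 1).toNat : ℝ) + 1 := by
      have h3 : ((⌈β⌉ - ⌊α⌋ - 1 : ℤ) : ℝ) ≤ ((⌈β⌉ - ⌊α⌋ - 1).toNat : ℝ) := by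
        exact_mod_cast Int.self_le_toNat _
      push_cast at h3
      linarith [Int.le_ceil β, Int.floor_le α]
    calc ENNReal.ofReal (β - α) ≤ ENNReal.ofReal (((⌈β⌉ - ⌊α⌋ - 1).toNat : ℝ) + 1) :=
          ENNReal.ofReal_le_ofReal h2
      _ = _ := by
          rw [ENNReal.ofReal_add (by positivity) zero_le_one, ENNReal.ofReal_natCast,
            ENNReal.ofReal_one]
  · have h1 : Measure.count ((fun n : ℤ => (n : ℝ)) ⁻¹' I)
        ≤ Measure.count ((fun n : ℤ => (n : ℝ)) ⁻¹' Icc α β) := measure_mono (preimage_mono hsub)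
    rw [Int.preimage_Icc, ← Finset.coe_Icc, Measure.count_apply_finset, Int.card_Icc] at h1
    refine h1.trans ?_
    have h2 : ((⌊β⌋ + 1 - ⌈α⌉).toNat : ℝ) ≤ (β - α) + 1 := by
      rcases le_total 0 (⌊β⌋ + 1 - ⌈α⌉) with h | h
      · have h3 : ((⌊β⌋ + 1 - ⌈α⌉).toNat : ℝ) = ((⌊β⌋ + 1 - ⌈α⌉ : ℤ) : ℝ) := by
          exact_mod_cast Int.toNat_of_nonneg h
        rw [h3]
        push_cast
        linarith [Int.le_ceil α, Int.floor_le β]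
      · rw [Int.toNat_of_nonpos h]
        push_cast
        linarith
    rw [← ENNReal.ofReal_natCast, ← ENNReal.ofReal_one, ← ENNReal.ofReal_add h0 zero_le_one]
    exact ENNReal.ofReal_le_ofReal h2

/-- A bounded quasi-concave function with bounded support has nearly the same sum over the integers
as its integral. -/
lemma lintegral_count_compare {f : ℝ → ℝ} {H : ℝ} (h0 : ∀ x, 0 ≤ f x) (hH : ∀ x, f x ≤ H)
    (hconv : ∀ t, Convex ℝ {x | t < f x}) (hbd : Bornology.IsBounded {x | 0 < f x}) :
    ∫⁻ x, ENNReal.ofReal (f x) ≤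
        (∫⁻ n : ℤ, ENNReal.ofReal (f n) ∂Measure.count) + ENNReal.ofReal H ∧
      ∫⁻ n : ℤ, ENNReal.ofReal (f n) ∂Measure.count ≤
        (∫⁻ x, ENNReal.ofReal (f x)) + ENNReal.ofReal H := by
  have hmeas : Measurable f := measurable_of_Ioi fun t => (hconv t).ordConnected.measurableSet
  have e1 := lintegral_eq_lintegral_meas_lt (volume : Measure ℝ) (f := f)
    (Filter.Eventually.of_forall h0) hmeas.aemeasurable
  have e2 := lintegral_eq_lintegral_meas_lt (Measure.count : Measure ℤ) (f := fun n : ℤ => f n)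
    (Filter.Eventually.of_forall fun n => h0 n) (measurable_of_countable _).aemeasurable
  -- Layer cake: each superlevel set is a bounded interval, where counting and length differ by at
  -- most 1. Levels t ≥ H are empty, so integrating over t costs H in total.
  have key : ∀ t ∈ Ioi (0 : ℝ),
      volume {a | t < f a} ≤
        Measure.count {n : ℤ | t < f n} + (Iio H).indicator (fun _ => (1 : ENNReal)) t ∧
      Measure.count {n : ℤ | t < f n} ≤
        volume {a | t < f a} + (Iio H).indicator (fun _ => (1 : ENNReal)) t := by
    intro t ht
    by_cases htH : t < H
    · rw [indicator_of_mem (by exact htH)]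
      exact volume_count_intCast_preimage (hconv t)
        (hbd.subset fun x hx => (mem_Ioi.1 ht).trans hx)
    · have h1 : {a | t < f a} = ∅ := by
        ext x; simpa using (hH x).trans (not_lt.1 htH)
      have h2 : {n : ℤ | t < f n} = ∅ := by
        ext x; simpa using (hH x).trans (not_lt.1 htH)
      rw [h1, h2]; simp
  have hind : Measurable ((Iio H).indicator (fun _ => (1 : ENNReal))) :=
    measurable_const.indicator measurableSet_Iio
  have hI : ∫⁻ t in Ioi (0 : ℝ), (Iio H).indicator (fun _ => (1 : ENNReal)) t
      = ENNReal.ofReal H := by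
    rw [lintegral_indicator measurableSet_Iio, Measure.restrict_restrict measurableSet_Iio]
    simp [Iio_inter_Ioi]
  rw [e1, e2, ← hI]
  constructor
  · rw [← lintegral_add_right _ hind]
    exact setLIntegral_mono' measurableSet_Ioi fun t ht => (key t ht).1
  · rw [← lintegral_add_right _ hind]
    exact setLIntegral_mono' measurableSet_Ioi fun t ht => (key t ht).2

lemma exists_sub_gt_of_lt_volume {I : Set ℝ} {t : ℝ} (ht : 0 ≤ t)
    (h : t < (volume I).toReal) : ∃ a ∈ I, ∃ b ∈ I, t < b - a := by
  by_contra! hcon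
  have h1 : volume I ≤ ENNReal.ofReal t := by
    refine (Real.volume_le_diam I).trans (Metric.ediam_le fun x hx y hy => ?_)
    rw [edist_dist, Real.dist_eq]
    refine ENNReal.ofReal_le_ofReal (abs_le.2 ⟨?_, hcon _ hy _ hx⟩)
    linarith [hcon _ hx _ hy]
  have h2 := ENNReal.toReal_mono ENNReal.ofReal_ne_top h1
  rw [ENNReal.toReal_ofReal ht] at h2
  linarith

/-- One-dimensional Brunn–Minkowski: a convex combination of two slices contains a segment whose
length is the combination of theirs. The bound `H` keeps slices of finite length, since `toReal`
sends ⊤ to 0. -/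
lemma convex_setOf_lt_volume_slice {S : Set (ℝ × ℝ)} (hS : Convex ℝ S) {H : ℝ}
    (hH : ∀ p ∈ S, ∀ q ∈ S, |p.2 - q.2| ≤ H) (t : ℝ) :
    Convex ℝ {x | t < (volume {y | (x, y) ∈ S}).toReal} := by
  rcases lt_or_ge t 0 with ht | ht
  · have : {x | t < (volume {y | (x, y) ∈ S}).toReal} = univ := by
      ext x; simpa using ht.trans_le ENNReal.toReal_nonneg
    rw [this]; exact convex_univ
  intro x hx z hz α β hα hβ hαβ
  obtain ⟨a, ha, b, hb, hab⟩ := exists_sub_gt_of_lt_volume ht hx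
  obtain ⟨c, hc, d, hd, hcd⟩ := exists_sub_gt_of_lt_volume ht hz
  have h1 : (α • x + β • z, α * a + β * c) ∈ S := hS ha hc hα hβ hαβ
  have h2 : (α • x + β • z, α * b + β * d) ∈ S := hS hb hd hα hβ hαβ
  have hlt : t < (α * b + β * d) - (α * a + β * c) := by
    rcases hα.eq_or_lt with rfl | hα'
    · have : β = 1 := by linarith
      subst this; linarith
    · nlinarith [mul_lt_mul_of_pos_left hab hα', mul_le_mul_of_nonneg_left hcd.le hβ]
  have hconv : Convex ℝ {y | (α • x + β • z, y) ∈ S} := by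
    intro y hy y' hy' s r hs hr hsr
    have := hS hy hy' hs hr hsr
    have e : s • (α • x + β • z, y) + r • (α • x + β • z, y')
        = (α • x + β • z, s • y + r • y') := by
      ext
      · simp only [Prod.smul_mk, Prod.mk_add_mk, ← add_smul, hsr, one_smul]
      · rfl
    rwa [e] at this
  have hsub : Icc (α * a + β * c) (α * b + β * d) ⊆ {y | (α • x + β • z, y) ∈ S} :=
    hconv.ordConnected.out h1 h2
  have hfin : volume {y | (α • x + β • z, y) ∈ S} ≠ ⊤ := by
    refine ne_top_of_le_ne_top (ENNReal.ofReal_ne_top (r := H))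
      ((Real.volume_le_diam _).trans (Metric.ediam_le fun u hu v hv => ?_))
    rw [edist_dist, Real.dist_eq]
    exact ENNReal.ofReal_le_ofReal (hH _ hu _ hv)
  have := ENNReal.toReal_mono hfin (measure_mono hsub)
  rw [Real.volume_Icc, ENNReal.toReal_ofReal (by linarith)] at this
  exact hlt.trans_le this

/-- A convex set need not be Borel, only null-measurable, so Tonelli is applied to a measurable
superset that agrees with it almost everywhere. -/
lemma volume_eq_lintegral_slice {S : Set (ℝ × ℝ)} (hS : Convex ℝ S) :
    volume S = ∫⁻ x, volume {y | (x, y) ∈ S} := by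
  obtain ⟨T, hST, hT, hae⟩ :=
    (hS.nullMeasurableSet (volume : Measure (ℝ × ℝ))).exists_measurable_superset_ae_eq
  rw [← measure_congr hae]
  have h1 : volume T = ∫⁻ x, volume (Prod.mk x ⁻¹' T) := Measure.prod_apply hT
  rw [h1]
  refine lintegral_congr_ae ?_
  have h2 : ∀ᵐ x : ℝ, ∀ᵐ y : ℝ, ((x, y) ∈ T) = ((x, y) ∈ S) := by
    have : ∀ᵐ z ∂((volume : Measure ℝ).prod (volume : Measure ℝ)), (z ∈ T) = (z ∈ S) := hae
    exact Measure.ae_ae_of_ae_prod this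
  filter_upwards [h2] with x hx
  exact measure_congr hx

/-- Lattice points in a convex set: the error is bounded by the widths. -/
theorem abs_ncard_sub_volume_le {S : Set (ℝ × ℝ)} (hS : Convex ℝ S) {W H : ℝ} (hW0 : 0 ≤ W)
    (hH0 : 0 ≤ H) (hW : ∀ p ∈ S, ∀ q ∈ S, |p.1 - q.1| ≤ W) (hH : ∀ p ∈ S, ∀ q ∈ S, |p.2 - q.2| ≤ H) :
    |(({p : ℤ × ℤ | ((p.1 : ℝ), (p.2 : ℝ)) ∈ S}.ncard : ℕ) : ℝ) - (volume S).toReal|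
      ≤ W + H + 1 := by
  classical
  have hslice : ∀ x : ℝ, Convex ℝ {y | (x, y) ∈ S} := fun x y hy y' hy' s r hs hr hsr => by
    have := hS hy hy' hs hr hsr
    have e : s • (x, y) + r • (x, y') = (x, s • y + r • y') := by
      ext
      · simp only [Prod.smul_mk, Prod.mk_add_mk, ← add_smul, hsr, one_smul]
      · rfl
    rwa [e] at this
  have hbs : ∀ x : ℝ, Bornology.IsBounded {y | (x, y) ∈ S} := fun x =>
    Metric.isBounded_iff.2 ⟨H, fun u hu v hv => by
      rw [Real.dist_eq]; exact hH _ hu _ hv⟩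
  have hvs : ∀ x : ℝ, volume {y | (x, y) ∈ S} ≤ ENNReal.ofReal H := fun x =>
    (Real.volume_le_diam _).trans (Metric.ediam_le fun u hu v hv => by
      rw [edist_dist, Real.dist_eq]
      exact ENNReal.ofReal_le_ofReal (hH _ hu _ hv))
  set ℓ : ℝ → ℝ := fun x => (volume {y | (x, y) ∈ S}).toReal with hℓ
  have hℓe : ∀ x, ENNReal.ofReal (ℓ x) = volume {y | (x, y) ∈ S} := fun x =>
    ENNReal.ofReal_toReal (ne_top_of_le_ne_top ENNReal.ofReal_ne_top (hvs x))
  set P : Set ℝ := Prod.fst '' S with hP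
  have hPc : Convex ℝ P := hS.linear_image (LinearMap.fst ℝ ℝ ℝ)
  have hPd : ∀ u ∈ P, ∀ v ∈ P, |u - v| ≤ W := by
    rintro _ ⟨p, hp, rfl⟩ _ ⟨q, hq, rfl⟩; exact hW p hp q hq
  have hPb : Bornology.IsBounded P := Metric.isBounded_iff.2 ⟨W, fun u hu v hv => by
      rw [Real.dist_eq]; exact hPd _ hu _ hv⟩
  have hPv : volume P ≤ ENNReal.ofReal W :=
    (Real.volume_le_diam _).trans (Metric.ediam_le fun u hu v hv => by
      rw [edist_dist, Real.dist_eq]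
      exact ENNReal.ofReal_le_ofReal (hPd _ hu _ hv))
  have hsub : {x | 0 < ℓ x} ⊆ P := by
    intro x hx
    obtain ⟨a, ha, -⟩ := exists_sub_gt_of_lt_volume le_rfl hx
    exact ⟨(x, a), ha, rfl⟩
  -- The error `W + H + 1` has two sources: replacing the integral of the slice lengths by a sum
  -- over integer abscissas costs `H`, and counting integers in each of the at most `W + 1` columns
  -- costs 1 per column.
  obtain ⟨c1, c2⟩ := lintegral_count_compare (f := ℓ) (H := H) (fun _ => ENNReal.toReal_nonneg)
    (fun x => by
      have := ENNReal.toReal_mono ENNReal.ofReal_ne_top (hvs x)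
      rwa [ENNReal.toReal_ofReal hH0] at this)
    (convex_setOf_lt_volume_slice hS hH) (hPb.subset hsub)
  simp only [hℓe, ← volume_eq_lintegral_slice hS] at c1 c2
  have hNcount : Measure.count ((fun n : ℤ => (n : ℝ)) ⁻¹' P) ≤ ENNReal.ofReal W + 1 :=
    (volume_count_intCast_preimage hPc hPb).2.trans (by gcongr)
  have hNfin : ((fun n : ℤ => (n : ℝ)) ⁻¹' P).Finite := by
    rw [← Measure.count_apply_lt_top]
    exact hNcount.trans_lt (by finiteness)
  set Z : Set (ℤ × ℤ) := {p : ℤ × ℤ | ((p.1 : ℝ), (p.2 : ℝ)) ∈ S} with hZ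
  have hprod : (Measure.count : Measure ℤ).prod (Measure.count : Measure ℤ) = Measure.count := by
    refine Measure.ext_of_singleton fun p => ?_
    rw [← Set.singleton_prod_singleton (a := p.1), Measure.prod_prod]
    simp
  have hcountZ : Measure.count Z =
      ∫⁻ n : ℤ, Measure.count ((fun m : ℤ => (m : ℝ)) ⁻¹' {y | ((n : ℝ), y) ∈ S})
        ∂Measure.count := by
    rw [← hprod, Measure.prod_apply (MeasurableSet.of_discrete)]
    rfl
  have hind : ∀ n : ℤ, n ∉ ((fun n : ℤ => (n : ℝ)) ⁻¹' P) → {y | ((n : ℝ), y) ∈ S} = ∅ := by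
    intro n hn
    ext y
    simp only [mem_ofPred_eq, mem_empty_iff_false, iff_false]
    exact fun hy => hn ⟨_, hy, rfl⟩
  have hIN : ∫⁻ n : ℤ, ((fun n : ℤ => (n : ℝ)) ⁻¹' P).indicator (fun _ => (1 : ENNReal)) n
      ∂Measure.count ≤ ENNReal.ofReal W + 1 := by
    rw [lintegral_indicator_const MeasurableSet.of_discrete, one_mul]
    exact hNcount
  have u1 : Measure.count Z ≤ volume S + ENNReal.ofReal (W + H + 1) := by
    calc Measure.count Z ≤ ∫⁻ n : ℤ, (volume {y | ((n : ℝ), y) ∈ S} +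
          ((fun n : ℤ => (n : ℝ)) ⁻¹' P).indicator (fun _ => (1 : ENNReal)) n) ∂Measure.count := by
          rw [hcountZ]
          refine lintegral_mono fun n => ?_
          by_cases hn : n ∈ ((fun n : ℤ => (n : ℝ)) ⁻¹' P)
          · rw [indicator_of_mem hn]
            exact (volume_count_intCast_preimage (hslice n) (hbs n)).2
          · rw [hind n hn]; simp
      _ ≤ (volume S + ENNReal.ofReal H) + (ENNReal.ofReal W + 1) := by
          rw [lintegral_add_right _ (measurable_of_countable _)]
          exact add_le_add c2 hIN
      _ = _ := by
          rw [ENNReal.ofReal_add (by positivity) zero_le_one, ENNReal.ofReal_add hW0 hH0,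
            ENNReal.ofReal_one]
          ring
  have u2 : volume S ≤ Measure.count Z + ENNReal.ofReal (W + H + 1) := by
    calc volume S ≤ (∫⁻ n : ℤ, volume {y | ((n : ℝ), y) ∈ S} ∂Measure.count)
            + ENNReal.ofReal H := c1
      _ ≤ (∫⁻ n : ℤ, (Measure.count ((fun m : ℤ => (m : ℝ)) ⁻¹' {y | ((n : ℝ), y) ∈ S}) +
          ((fun n : ℤ => (n : ℝ)) ⁻¹' P).indicator (fun _ => (1 : ENNReal)) n) ∂Measure.count)
            + ENNReal.ofReal H := by
          gcongr with n
          by_cases hn : n ∈ ((fun n : ℤ => (n : ℝ)) ⁻¹' P)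
          · rw [indicator_of_mem hn]
            exact (volume_count_intCast_preimage (hslice n) (hbs n)).1
          · rw [hind n hn]; simp
      _ ≤ (Measure.count Z + (ENNReal.ofReal W + 1)) + ENNReal.ofReal H := by
          rw [lintegral_add_right _ (measurable_of_countable _), ← hcountZ]
          gcongr
      _ = _ := by
          rw [ENNReal.ofReal_add (by positivity) zero_le_one, ENNReal.ofReal_add hW0 hH0,
            ENNReal.ofReal_one]
          ring
  have hSfin : volume S ≠ ⊤ := by
    have hSb : Bornology.IsBounded S := Metric.isBounded_iff.2 ⟨max W H, fun p hp q hq => by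
      rw [Prod.dist_eq, Real.dist_eq, Real.dist_eq]
      exact max_le_max (hW p hp q hq) (hH p hp q hq)⟩
    exact hSb.measure_lt_top.ne
  have hZfin : Measure.count Z ≠ ⊤ := ne_top_of_le_ne_top (by finiteness) u1
  have hZf : Z.Finite := Measure.count_apply_lt_top.1 hZfin.lt_top
  have hZn : (Measure.count Z).toReal = (Z.ncard : ℝ) := by
    rw [Measure.count_apply_finite _ hZf, ncard_eq_toFinset_card _ hZf]
    simp
  have hpos : 0 ≤ W + H + 1 := by positivity
  rw [← hZn, abs_le]
  constructor
  · have := ENNReal.toReal_mono (by finiteness) u2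
    rw [ENNReal.toReal_add hZfin (by finiteness), ENNReal.toReal_ofReal hpos] at this
    linarith
  · have := ENNReal.toReal_mono (by finiteness) u1
    rw [ENNReal.toReal_add hSfin (by finiteness), ENNReal.toReal_ofReal hpos] at this
    linarith

/-! ### Regions with bounded perimeter and planar lattices. -/

/-- Projecting the frontier to a coordinate axis bounds the widths of a region. -/
lemma abs_sub_le_of_mem_regions {M : ℝ} (hM : 0 ≤ M) {R : Set (EuclideanSpace ℝ (Fin 2))}
    (hR : R ∈ regions M) (i : Fin 2) {x y : EuclideanSpace ℝ (Fin 2)} (hx : x ∈ R) (hy : y ∈ R) :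
    |x i - y i| ≤ M := by
  obtain ⟨hc, hb, hfr⟩ := hR
  wlog hxy : y i ≤ x i generalizing x y
  · rw [abs_sub_comm]; exact this hy hx (le_of_not_ge hxy)
  rw [abs_of_nonneg (by linarith)]
  have hsub : Icc (y i) (x i) ⊆ (fun p : EuclideanSpace ℝ (Fin 2) => p i) '' frontier R := by
    intro t ht
    have hconvimg : Convex ℝ ((fun p : EuclideanSpace ℝ (Fin 2) => p i) '' R) :=
      hc.linear_image (EuclideanSpace.proj i : EuclideanSpace ℝ (Fin 2) →L[ℝ] ℝ).toLinearMap
    obtain ⟨p, hp, hpt⟩ := hconvimg.ordConnected.out ⟨y, hy, rfl⟩ ⟨x, hx, rfl⟩ ht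
    -- In `Fin 2` the index `1 - i` is the other coordinate. The line through `p` in that direction
    -- meets `R` and leaves it, since `R` is bounded, so by connectedness it meets the frontier, at
    -- a point with the same i-th coordinate as `p`.
    set e : EuclideanSpace ℝ (Fin 2) := EuclideanSpace.single (1 - i) (1 : ℝ) with he
    have hei : e i = 0 := by
      rw [he]; fin_cases i <;> simp
    have hen : ‖e‖ = 1 := by simp [he]
    set line : Set (EuclideanSpace ℝ (Fin 2)) := range fun s : ℝ => p + s • e with hline
    have hconn : IsPreconnected line := isPreconnected_range (by fun_prop)
    have hmeet : (line ∩ R).Nonempty := ⟨p, ⟨0, by simp⟩, hp⟩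
    have hout : (line ∩ Rᶜ).Nonempty := by
      obtain ⟨r, hr⟩ := hb.subset_ball p
      refine ⟨p + r • e, ⟨r, rfl⟩, fun hmem => ?_⟩
      have := hr hmem
      rw [Metric.mem_ball, dist_eq_norm, add_sub_cancel_left, norm_smul, hen, mul_one,
        Real.norm_eq_abs] at this
      exact absurd (le_abs_self r) (not_le.2 this)
    obtain ⟨w, hw, hwf⟩ : (line ∩ frontier R).Nonempty := by
      by_contra hemp
      have hcov : line ⊆ interior R ∪ interior Rᶜ := by
        intro w hw
        rw [← compl_frontier_eq_union_interior]
        exact fun hwf => hemp ⟨w, hw, hwf⟩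
      have hin : (line ∩ interior R).Nonempty := by
        obtain ⟨w, hw, hwR⟩ := hmeet
        exact ⟨w, hw, (hcov hw).resolve_right fun h => interior_subset h hwR⟩
      have hin' : (line ∩ interior Rᶜ).Nonempty := by
        obtain ⟨w, hw, hwR⟩ := hout
        exact ⟨w, hw, (hcov hw).resolve_left fun h => hwR (interior_subset h)⟩
      obtain ⟨w, -, hw1, hw2⟩ := hconn _ _ isOpen_interior isOpen_interior hcov hin hin'
      exact interior_subset hw2 (interior_subset hw1)
    obtain ⟨s, rfl⟩ := hw
    exact ⟨_, hwf, by simp [hei, hpt]⟩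
  have hlip : LipschitzOnWith 1 (fun p : EuclideanSpace ℝ (Fin 2) => p i) (frontier R) :=
    LipschitzWith.lipschitzOnWith (LipschitzWith.of_dist_le_mul fun p q => by
      simpa [Real.dist_eq, dist_eq_norm] using PiLp.norm_apply_le (p - q) i)
  have h1 := hlip.hausdorffMeasure_image_le (d := 1) zero_le_one
  rw [hausdorffMeasure_real] at h1
  have h2 : volume (Icc (y i) (x i)) ≤ ENNReal.ofReal M :=
    (measure_mono hsub).trans (h1.trans (by simpa using hfr))
  rw [Real.volume_Icc] at h2
  exact (ENNReal.ofReal_le_ofReal_iff hM).1 h2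

lemma volume_preimage_pair (R : Set (EuclideanSpace ℝ (Fin 2))) :
    volume {p : ℝ × ℝ | (!₂[p.1, p.2] : EuclideanSpace ℝ (Fin 2)) ∈ R} = volume R := by
  have h1 := (EuclideanSpace.volume_preserving_symm_measurableEquiv_toLp (Fin 2)).symm
  have h2 := (volume_preserving_finTwoArrow ℝ).symm
  have h4 := (h2.measure_preimage_equiv
    ((MeasurableEquiv.toLp 2 (Fin 2 → ℝ)) ⁻¹' R))
  have h5 := h1.measure_preimage_equiv R
  exact h4.trans h5

lemma volume_preimage_affine (a b : ℝ × ℝ) (t : ℝ × ℝ) (hΔ : a.1 * b.2 - b.1 * a.2 ≠ 0)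
    (R : Set (ℝ × ℝ)) :
    volume {p : ℝ × ℝ | (t.1 + p.1 * a.1 + p.2 * b.1, t.2 + p.1 * a.2 + p.2 * b.2) ∈ R}
      = ENNReal.ofReal |(a.1 * b.2 - b.1 * a.2)⁻¹| * volume R := by
  set f : ℝ × ℝ →ₗ[ℝ] ℝ × ℝ :=
    Matrix.toLin (Module.Basis.finTwoProd ℝ) (Module.Basis.finTwoProd ℝ) !![a.1, b.1; a.2, b.2] with hf
  have hdet : LinearMap.det f = a.1 * b.2 - b.1 * a.2 := by
    rw [hf, LinearMap.det_toLin, Matrix.det_fin_two_of]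
  have h := Measure.addHaar_preimage_linearMap (volume : Measure (ℝ × ℝ)) (f := f)
    (by rwa [hdet]) ((fun p => t + p) ⁻¹' R)
  rw [measure_preimage_add, hdet] at h
  rw [← h]
  congr 1
  ext p
  simp only [mem_ofPred_eq, mem_preimage, hf, Matrix.toLin_finTwoProd_apply]
  have e : t + (a.1 * p.1 + b.1 * p.2, a.2 * p.1 + b.2 * p.2)
      = (t.1 + p.1 * a.1 + p.2 * b.1, t.2 + p.1 * a.2 + p.2 * b.2) := by
    ext <;> simp <;> ring
  simp [← e]

/-- Counting the points of a translated planar lattice in a region. -/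
theorem abs_ncard_lattice_sub_le {M : ℝ} (hM : 0 ≤ M) {R : Set (EuclideanSpace ℝ (Fin 2))}
    (hR : R ∈ regions M) (t₀ U V : ℤ × ℤ) (hΔ : U.1 * V.2 - V.1 * U.2 ≠ 0) :
    |(({x : ℤ × ℤ | (∃ s t : ℤ, x = t₀ + s • U + t • V) ∧ toPlane x ∈ R}.ncard : ℕ) : ℝ)
        - (volume R).toReal / (|((U.1 * V.2 - V.1 * U.2 : ℤ) : ℝ)|)| ≤
      M * (|(U.1 : ℝ)| + |(U.2 : ℝ)| + |(V.1 : ℝ)| + |(V.2 : ℝ)|)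
        / |((U.1 * V.2 - V.1 * U.2 : ℤ) : ℝ)| + 1 := by
  set Δ : ℝ := ((U.1 * V.2 - V.1 * U.2 : ℤ) : ℝ) with hΔdef
  have hΔ0 : Δ ≠ 0 := by rw [hΔdef]; exact_mod_cast hΔ
  have hΔp : 0 < |Δ| := abs_pos.2 hΔ0
  have hΔe : (U.1 : ℝ) * V.2 - V.1 * U.2 = Δ := by rw [hΔdef]; push_cast; ring
  set S : Set (ℝ × ℝ) := {p | (!₂[(t₀.1 : ℝ) + p.1 * U.1 + p.2 * V.1,
    (t₀.2 : ℝ) + p.1 * U.2 + p.2 * V.2] : EuclideanSpace ℝ (Fin 2)) ∈ R} with hS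
  have hvol : (volume S).toReal = (volume R).toReal / |Δ| := by
    have h := volume_preimage_affine ((U.1 : ℝ), (U.2 : ℝ)) ((V.1 : ℝ), (V.2 : ℝ))
      ((t₀.1 : ℝ), (t₀.2 : ℝ)) (by simpa [hΔe] using hΔ0)
      {p : ℝ × ℝ | (!₂[p.1, p.2] : EuclideanSpace ℝ (Fin 2)) ∈ R}
    rw [volume_preimage_pair] at h
    have h' : volume S = ENNReal.ofReal |((U.1 : ℝ) * V.2 - V.1 * U.2)⁻¹| * volume R := h
    rw [h', hΔe, ENNReal.toReal_mul, ENNReal.toReal_ofReal (abs_nonneg _), abs_inv]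
    field_simp
  have hSc : Convex ℝ S := by
    intro p hp q hq α β hα hβ hαβ
    have := hR.1 hp hq hα hβ hαβ
    have e : α • (!₂[(t₀.1 : ℝ) + p.1 * U.1 + p.2 * V.1,
        (t₀.2 : ℝ) + p.1 * U.2 + p.2 * V.2] : EuclideanSpace ℝ (Fin 2)) +
        β • (!₂[(t₀.1 : ℝ) + q.1 * U.1 + q.2 * V.1,
        (t₀.2 : ℝ) + q.1 * U.2 + q.2 * V.2] : EuclideanSpace ℝ (Fin 2)) =
        !₂[(t₀.1 : ℝ) + (α • p + β • q).1 * U.1 + (α • p + β • q).2 * V.1,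
        (t₀.2 : ℝ) + (α • p + β • q).1 * U.2 + (α • p + β • q).2 * V.2] := by
      have hβ' : β = 1 - α := by linarith
      ext i
      fin_cases i <;> simp [hβ'] <;> ring
    rw [e] at this
    exact this
  have hdiff : ∀ p ∈ S, ∀ q ∈ S,
      |(p.1 - q.1) * U.1 + (p.2 - q.2) * V.1| ≤ M ∧
      |(p.1 - q.1) * U.2 + (p.2 - q.2) * V.2| ≤ M := by
    intro p hp q hq
    have h0 := abs_sub_le_of_mem_regions hM hR 0 hp hq
    have h1 := abs_sub_le_of_mem_regions hM hR 1 hp hq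
    simp only [Matrix.cons_val_zero, Matrix.cons_val_one] at h0 h1
    exact ⟨by convert h0 using 2; ring, by convert h1 using 2; ring⟩
  -- Cramer's rule: the widths of the pulled-back region are read off from the two coordinate widths
  -- of `R`.
  have hW : ∀ p ∈ S, ∀ q ∈ S, |p.1 - q.1| ≤ M * (|(V.1 : ℝ)| + |(V.2 : ℝ)|) / |Δ| := by
    intro p hp q hq
    obtain ⟨h0, h1⟩ := hdiff p hp q hq
    rw [le_div_iff₀ hΔp, ← abs_mul, ← hΔe]
    calc |(p.1 - q.1) * ((U.1 : ℝ) * V.2 - V.1 * U.2)|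
        = |((p.1 - q.1) * U.1 + (p.2 - q.2) * V.1) * V.2
          - ((p.1 - q.1) * U.2 + (p.2 - q.2) * V.2) * V.1| := by congr 1; ring
      _ ≤ |(p.1 - q.1) * U.1 + (p.2 - q.2) * V.1| * |(V.2 : ℝ)|
          + |(p.1 - q.1) * U.2 + (p.2 - q.2) * V.2| * |(V.1 : ℝ)| := by
          rw [← abs_mul, ← abs_mul]; exact abs_sub _ _
      _ ≤ M * |(V.2 : ℝ)| + M * |(V.1 : ℝ)| := by gcongr
      _ = _ := by ring
  have hH : ∀ p ∈ S, ∀ q ∈ S, |p.2 - q.2| ≤ M * (|(U.1 : ℝ)| + |(U.2 : ℝ)|) / |Δ| := by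
    intro p hp q hq
    obtain ⟨h0, h1⟩ := hdiff p hp q hq
    rw [le_div_iff₀ hΔp, ← abs_mul, ← hΔe]
    calc |(p.2 - q.2) * ((U.1 : ℝ) * V.2 - V.1 * U.2)|
        = |((p.1 - q.1) * U.2 + (p.2 - q.2) * V.2) * U.1
          - ((p.1 - q.1) * U.1 + (p.2 - q.2) * V.1) * U.2| := by congr 1; ring
      _ ≤ |(p.1 - q.1) * U.2 + (p.2 - q.2) * V.2| * |(U.1 : ℝ)|
          + |(p.1 - q.1) * U.1 + (p.2 - q.2) * V.1| * |(U.2 : ℝ)| := by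
          rw [← abs_mul, ← abs_mul]; exact abs_sub _ _
      _ ≤ M * |(U.1 : ℝ)| + M * |(U.2 : ℝ)| := by gcongr
      _ = _ := by ring
  have hmain := abs_ncard_sub_volume_le hSc (by positivity) (by positivity) hW hH
  have hcard : {x : ℤ × ℤ | (∃ s t : ℤ, x = t₀ + s • U + t • V) ∧ toPlane x ∈ R}.ncard
      = {p : ℤ × ℤ | ((p.1 : ℝ), (p.2 : ℝ)) ∈ S}.ncard := by
    have hinj : Function.Injective fun p : ℤ × ℤ => t₀ + p.1 • U + p.2 • V := by
      intro p q hpq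
      simp only [Prod.ext_iff, Prod.fst_add, Prod.snd_add, Prod.smul_fst, Prod.smul_snd,
        smul_eq_mul] at hpq
      obtain ⟨e1, e2⟩ := hpq
      have f1 : (p.1 - q.1) * (U.1 * V.2 - V.1 * U.2) = 0 := by
        linear_combination V.2 * e1 - V.1 * e2
      have f2 : (p.2 - q.2) * (U.1 * V.2 - V.1 * U.2) = 0 := by
        linear_combination U.1 * e2 - U.2 * e1
      exact Prod.ext (sub_eq_zero.1 ((mul_eq_zero.1 f1).resolve_right hΔ))
        (sub_eq_zero.1 ((mul_eq_zero.1 f2).resolve_right hΔ))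
    symm
    rw [← ncard_image_of_injective _ hinj]
    symm
    congr 1
    have hpl : ∀ s t : ℤ, toPlane (t₀ + s • U + t • V) =
        !₂[(t₀.1 : ℝ) + (s : ℝ) * U.1 + (t : ℝ) * V.1,
          (t₀.2 : ℝ) + (s : ℝ) * U.2 + (t : ℝ) * V.2] := by
      intro s t
      simp [toPlane]
    ext x
    constructor
    · rintro ⟨⟨s, t, rfl⟩, hx⟩
      rw [hpl] at hx
      exact ⟨(s, t), hx, rfl⟩
    · rintro ⟨p, hp, rfl⟩
      refine ⟨⟨p.1, p.2, rfl⟩, ?_⟩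
      show toPlane (t₀ + p.1 • U + p.2 • V) ∈ R
      rw [hpl]
      exact hp
  rw [hcard, ← hvol]
  refine hmain.trans (le_of_eq ?_)
  ring

/-! ### Reduced bases and shortest vectors of congruence lattices. -/

/-- The squared Euclidean length of an integer vector. -/
def sqNorm (w : ℤ × ℤ) : ℤ := w.1 ^ 2 + w.2 ^ 2

lemma sqNorm_pos {w : ℤ × ℤ} (hw : w ≠ 0) : 0 < sqNorm w := by
  unfold sqNorm
  by_contra h
  refine hw (Prod.ext ?_ ?_)
  · exact pow_eq_zero_iff two_ne_zero |>.1 (le_antisymm (by nlinarith [sq_nonneg w.2]) (sq_nonneg _))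
  · exact pow_eq_zero_iff two_ne_zero |>.1 (le_antisymm (by nlinarith [sq_nonneg w.1]) (sq_nonneg _))

/-- The pair `U, V` is a basis of the lattice `w₁ ≡ A w₂ (mod m)`. -/
def IsCongrBasis (m : ℕ) (A : ℤ) (p : (ℤ × ℤ) × (ℤ × ℤ)) : Prop :=
  (∀ w : ℤ × ℤ, (m : ℤ) ∣ w.1 - A * w.2 ↔ ∃ s t : ℤ, w = s • p.1 + t • p.2) ∧
    |p.1.1 * p.2.2 - p.2.1 * p.1.2| = m

lemma IsCongrBasis.swap {m : ℕ} {A : ℤ} {U V : ℤ × ℤ} (h : IsCongrBasis m A (U, V)) :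
    IsCongrBasis m A (V, U) := by
  refine ⟨fun w => (h.1 w).trans ⟨?_, ?_⟩, ?_⟩
  · rintro ⟨s, t, rfl⟩; exact ⟨t, s, add_comm _ _⟩
  · rintro ⟨s, t, rfl⟩; exact ⟨t, s, add_comm _ _⟩
  · rw [← h.2, ← abs_neg]; congr 1; ring

lemma IsCongrBasis.add {m : ℕ} {A : ℤ} {U V : ℤ × ℤ} (h : IsCongrBasis m A (U, V)) (ε : ℤ) :
    IsCongrBasis m A (U, V + ε • U) := by
  refine ⟨fun w => (h.1 w).trans ⟨?_, ?_⟩, ?_⟩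
  · rintro ⟨s, t, rfl⟩
    exact ⟨s - t * ε, t, by simp only [smul_add, sub_smul, mul_smul]; abel⟩
  · rintro ⟨s, t, rfl⟩
    exact ⟨s + t * ε, t, by simp only [smul_add, add_smul, mul_smul]; abel⟩
  · rw [← h.2]; congr 1; simp; ring

lemma isCongrBasis_standard (m : ℕ) (A : ℤ) : IsCongrBasis m A (((m : ℤ), 0), (A, 1)) := by
  refine ⟨fun w => ⟨?_, ?_⟩, by simp⟩
  · rintro ⟨k, hk⟩
    refine ⟨k, w.2, Prod.ext ?_ ?_⟩
    · simp; linarith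
    · simp
  · rintro ⟨s, t, rfl⟩
    exact ⟨s, by simp; ring⟩

/-- A Gauss-reduced basis. -/
lemma exists_reduced_basis (m : ℕ) (A : ℤ) :
    ∃ U V : ℤ × ℤ, IsCongrBasis m A (U, V) ∧ sqNorm U ≤ sqNorm V ∧
      3 * (sqNorm U * sqNorm V) ≤ 4 * (m : ℤ) ^ 2 := by
  obtain ⟨p, hp, hmin⟩ := (measure fun p : (ℤ × ℤ) × (ℤ × ℤ) =>
    (sqNorm p.1 + sqNorm p.2).toNat).wf.has_min {p | IsCongrBasis m A p}
    ⟨_, isCongrBasis_standard m A⟩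
  have h0 : ∀ w, 0 ≤ sqNorm w := fun w => by unfold sqNorm; positivity
  have hmin' : ∀ r, IsCongrBasis m A r → sqNorm p.1 + sqNorm p.2 ≤ sqNorm r.1 + sqNorm r.2 := by
    intro r hr
    have h1 : ¬ (sqNorm r.1 + sqNorm r.2).toNat < (sqNorm p.1 + sqNorm p.2).toNat := hmin r hr
    have := h0 r.1; have := h0 r.2; have := h0 p.1; have := h0 p.2
    omega
  obtain ⟨U, V, hUV, hle, hm⟩ : ∃ U V, IsCongrBasis m A (U, V) ∧ sqNorm U ≤ sqNorm V ∧
      ∀ r, IsCongrBasis m A r → sqNorm U + sqNorm V ≤ sqNorm r.1 + sqNorm r.2 := by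
    rcases le_total (sqNorm p.1) (sqNorm p.2) with h | h
    · exact ⟨p.1, p.2, hp, h, hmin'⟩
    · exact ⟨p.2, p.1, IsCongrBasis.swap hp, h, fun r hr => by linarith [hmin' r hr]⟩
  refine ⟨U, V, hUV, hle, ?_⟩
  -- Minimality against V ± U gives 2|U·V| ≤ |U|². Lagrange's identity |U|²|V|² = m² + (U·V)² then
  -- yields the constant 4/3.
  have h1 := hm _ (hUV.add 1)
  have h2 := hm _ (hUV.add (-1))
  have hd : (U.1 * V.2 - V.1 * U.2) ^ 2 = (m : ℤ) ^ 2 := by rw [← sq_abs, hUV.2]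
  set I := U.1 * V.1 + U.2 * V.2 with hI
  have e1 : sqNorm (V + (1 : ℤ) • U) = sqNorm V + 2 * I + sqNorm U := by
    simp [sqNorm, hI]; ring
  have e2 : sqNorm (V + (-1 : ℤ) • U) = sqNorm V - 2 * I + sqNorm U := by
    simp [sqNorm, hI]; ring
  simp only [e1, e2] at h1 h2
  have e3 : sqNorm U * sqNorm V = (m : ℤ) ^ 2 + I ^ 2 := by
    rw [← hd]; simp [sqNorm, hI]; ring
  have h3 : 4 * I ^ 2 ≤ sqNorm U * sqNorm V := by
    have a1 : 0 ≤ (sqNorm U - 2 * I) * (sqNorm U + 2 * I) :=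
      mul_nonneg (by linarith) (by linarith)
    have a2 : sqNorm U * sqNorm U ≤ sqNorm U * sqNorm V :=
      mul_le_mul_of_nonneg_left hle (h0 U)
    nlinarith
  linarith

/-- A shortest nonzero vector of the lattice `w₁ ≡ A w₂ (mod n)`. -/
lemma exists_shortest {n : ℕ} (hn : 0 < n) (A : ℤ) :
    ∃ v : ℤ × ℤ, v ≠ 0 ∧ (n : ℤ) ∣ v.1 - A * v.2 ∧ sqNorm v ≤ 2 * n ∧
      ∀ w : ℤ × ℤ, w ≠ 0 → (n : ℤ) ∣ w.1 - A * w.2 → sqNorm v ≤ sqNorm w := by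
  obtain ⟨U, V, hUV, hle, hr⟩ := exists_reduced_basis n A
  have hdet : U.1 * V.2 - V.1 * U.2 ≠ 0 := by
    intro h
    have := hUV.2
    simp only [h, abs_zero] at this
    omega
  have hU0 : U ≠ 0 := by
    rintro rfl; simp at hdet
  have hUm : (n : ℤ) ∣ U.1 - A * U.2 := (hUV.1 U).2 ⟨1, 0, by simp⟩
  obtain ⟨v, ⟨hv0, hvm⟩, hmin⟩ := (measure fun w : ℤ × ℤ => (sqNorm w).toNat).wf.has_min
    {w | w ≠ 0 ∧ (n : ℤ) ∣ w.1 - A * w.2} ⟨U, hU0, hUm⟩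
  have hmin' : ∀ w : ℤ × ℤ, w ≠ 0 → (n : ℤ) ∣ w.1 - A * w.2 → sqNorm v ≤ sqNorm w := by
    intro w hw hwm
    have h1 : ¬ (sqNorm w).toNat < (sqNorm v).toNat := hmin w ⟨hw, hwm⟩
    have := sqNorm_pos hw; have := sqNorm_pos hv0
    omega
  refine ⟨v, hv0, hvm, ?_, hmin'⟩
  refine (hmin' U hU0 hUm).trans ?_
  have hp := sqNorm_pos hU0
  by_contra! h
  have : (0 : ℤ) ≤ n := by positivity
  nlinarith [mul_le_mul_of_nonneg_left hle hp.le]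

/-- Points of `R` in a congruence class modulo `D`, on the lattice `x₁ ≡ A x₂ (mod n)`, with
`e ∣ x₂`. -/
lemma abs_ncard_congruence_sub_le {M : ℝ} (hM : 0 ≤ M) {R : Set (EuclideanSpace ℝ (Fin 2))}
    (hR : R ∈ regions M) {n e : ℕ} (hn : 0 < n) (hen : e ∣ n) (A : ℤ) {D : ℤ} (hD : D ≠ 0)
    (hnD : IsCoprime (n : ℤ) D) (z : ℤ × ℤ) {ℓ : ℝ} (hℓ : 0 < ℓ)
    (hmin : ∀ w : ℤ × ℤ, w ≠ 0 → (n : ℤ) ∣ w.1 - A * w.2 → ℓ ^ 2 ≤ (sqNorm w : ℝ)) :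
    |((({x : ℤ × ℤ | (n : ℤ) ∣ x.1 - A * x.2 ∧ (e : ℤ) ∣ x.2} ∩ toPlane ⁻¹' R
        ∩ psiSet D z).ncard : ℕ) : ℝ) - (volume R).toReal / ((D : ℝ) ^ 2 * n * e)| ≤
      8 * M / ℓ + 1 := by
  obtain ⟨m, rfl⟩ := hen
  have he : 0 < e := Nat.pos_of_mul_pos_right hn
  have hm : 0 < m := Nat.pos_of_mul_pos_left hn
  obtain ⟨U, V, hUV, hle, hr⟩ := exists_reduced_basis m A
  have hdet : |U.1 * V.2 - V.1 * U.2| = (m : ℤ) := hUV.2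
  have hdet0 : U.1 * V.2 - V.1 * U.2 ≠ 0 := by
    intro h
    simp only [h, abs_zero] at hdet
    omega
  have heD : IsCoprime (e : ℤ) D := hnD.of_isCoprime_of_dvd_left (by push_cast; exact dvd_mul_right _ _)
  have hmD : IsCoprime (m : ℤ) D := hnD.of_isCoprime_of_dvd_left (by push_cast; exact dvd_mul_left _ _)
  have he0 : (e : ℤ) ≠ 0 := by exact_mod_cast he.ne'
  obtain ⟨a, b, hab⟩ := hnD
  -- Chinese remainder: `t₀` is ≡ z mod D and ≡ 0 mod n. As e divides n and x₂, it divides x₁ too,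
  -- so the points form `t₀` plus D e times the lattice of level m = n/e, of covolume D² n e.
  set t₀ : ℤ × ℤ := (a * ((e * m : ℕ) : ℤ)) • z with ht₀
  have hset : {x : ℤ × ℤ | ((e * m : ℕ) : ℤ) ∣ x.1 - A * x.2 ∧ (e : ℤ) ∣ x.2} ∩ toPlane ⁻¹' R
        ∩ psiSet D z = {x : ℤ × ℤ | (∃ s t : ℤ, x = t₀ + s • ((D * e) • U) + t • ((D * e) • V)) ∧
          toPlane x ∈ R} := by
    ext x
    simp only [mem_inter_iff, mem_ofPred_eq, mem_preimage, psiSet]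
    have hz1 : z.1 - t₀.1 = D * (b * z.1) := by
      simp only [ht₀, Prod.smul_fst, smul_eq_mul]; linear_combination (-z.1) * hab
    have hz2 : z.2 - t₀.2 = D * (b * z.2) := by
      simp only [ht₀, Prod.smul_snd, smul_eq_mul]; linear_combination (-z.2) * hab
    constructor
    · rintro ⟨⟨⟨h1, h2⟩, hxR⟩, hz⟩
      refine ⟨?_, hxR⟩
      have d1 : D ∣ x.1 - t₀.1 := by
        have := dvd_add (Int.ModEq.dvd hz.1.symm) (Dvd.intro _ hz1.symm)
        simpa using this
      have d2 : D ∣ x.2 - t₀.2 := by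
        have := dvd_add (Int.ModEq.dvd hz.2.symm) (Dvd.intro _ hz2.symm)
        simpa using this
      have k2 : (e : ℤ) ∣ x.2 - t₀.2 := dvd_sub h2 (by
        simp only [ht₀, Prod.smul_snd, smul_eq_mul]; push_cast
        exact ⟨a * m * z.2, by ring⟩)
      have kn : ((e * m : ℕ) : ℤ) ∣ (x.1 - t₀.1) - A * (x.2 - t₀.2) := by
        have : (x.1 - t₀.1) - A * (x.2 - t₀.2) = (x.1 - A * x.2)
          - ((e * m : ℕ) : ℤ) * (a * z.1 - A * (a * z.2)) := by
          simp only [ht₀, Prod.smul_snd, Prod.smul_fst, smul_eq_mul]; ring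
        rw [this]
        exact dvd_sub h1 (dvd_mul_right _ _)
      have k1 : (e : ℤ) ∣ x.1 - t₀.1 := by
        have h3 : (e : ℤ) ∣ (x.1 - t₀.1) - A * (x.2 - t₀.2) :=
          dvd_trans (by push_cast; exact dvd_mul_right _ _) kn
        have := dvd_add h3 (k2.mul_left A)
        simpa using this
      obtain ⟨w1, hw1⟩ := heD.symm.mul_dvd d1 k1
      obtain ⟨w2, hw2⟩ := heD.symm.mul_dvd d2 k2
      have hw : (m : ℤ) ∣ w1 - A * w2 := by
        rw [hw1, hw2] at kn
        have h4 : (e : ℤ) * m ∣ e * (D * (w1 - A * w2)) := by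
          convert kn using 1
          · push_cast; ring
          · ring
        exact hmD.dvd_of_dvd_mul_left ((mul_dvd_mul_iff_left he0).1 h4)
      obtain ⟨s, t, hst⟩ := (hUV.1 (w1, w2)).1 hw
      refine ⟨s, t, ?_⟩
      have e1 := congrArg Prod.fst hst
      have e2 := congrArg Prod.snd hst
      simp only [Prod.fst_add, Prod.snd_add, Prod.smul_fst, Prod.smul_snd, smul_eq_mul] at e1 e2
      refine Prod.ext ?_ ?_
      · simp only [Prod.fst_add, Prod.smul_fst, smul_eq_mul]
        linear_combination hw1 + D * e * e1
      · simp only [Prod.snd_add, Prod.smul_snd, smul_eq_mul]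
        linear_combination hw2 + D * e * e2
    · rintro ⟨⟨s, t, hst⟩, hxR⟩
      have e1 := congrArg Prod.fst hst
      have e2 := congrArg Prod.snd hst
      simp only [Prod.fst_add, Prod.snd_add, Prod.smul_fst, Prod.smul_snd, smul_eq_mul] at e1 e2
      obtain ⟨k, hk⟩ := (hUV.1 (s • U + t • V)).2 ⟨s, t, rfl⟩
      simp only [Prod.fst_add, Prod.snd_add, Prod.smul_fst, Prod.smul_snd, smul_eq_mul] at hk
      refine ⟨⟨⟨⟨a * (z.1 - A * z.2) + D * k, ?_⟩, ⟨a * m * z.2 + D * (s * U.2 + t * V.2), ?_⟩⟩, hxR⟩,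
        Int.ModEq.symm ((Int.modEq_iff_dvd).2 ⟨e * (s * U.1 + t * V.1) - b * z.1, ?_⟩),
        Int.ModEq.symm ((Int.modEq_iff_dvd).2 ⟨e * (s * U.2 + t * V.2) - b * z.2, ?_⟩)⟩
      · rw [e1, e2]
        simp only [ht₀, Prod.smul_snd, Prod.smul_fst, smul_eq_mul]; push_cast
        linear_combination D * e * hk
      · rw [e2]
        simp only [ht₀, Prod.smul_snd, smul_eq_mul]; push_cast
        ring
      · linear_combination e1 - hz1
      · linear_combination e2 - hz2
  have hΔ' : ((D * e) • U).1 * ((D * e) • V).2 - ((D * e) • V).1 * ((D * e) • U).2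
      = (D * e) ^ 2 * (U.1 * V.2 - V.1 * U.2) := by
    simp only [Prod.smul_fst, Prod.smul_snd, smul_eq_mul]; ring
  have hΔ0 : ((D * e) • U).1 * ((D * e) • V).2 - ((D * e) • V).1 * ((D * e) • U).2 ≠ 0 := by
    rw [hΔ']
    exact mul_ne_zero (pow_ne_zero _ (mul_ne_zero hD he0)) hdet0
  have hmain := abs_ncard_lattice_sub_le hM hR t₀ ((D * e) • U) ((D * e) • V) hΔ0
  have habs : |((((D * e) • U).1 * ((D * e) • V).2 - ((D * e) • V).1 * ((D * e) • U).2 : ℤ) : ℝ)|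
      = (D : ℝ) ^ 2 * e ^ 2 * m := by
    rw [hΔ', ← Int.cast_abs, abs_mul, hdet, abs_of_nonneg (sq_nonneg _)]
    push_cast; ring
  rw [habs, ← hset] at hmain
  have hdiv : (D : ℝ) ^ 2 * ((e * m : ℕ) : ℝ) * e = (D : ℝ) ^ 2 * e ^ 2 * m := by
    push_cast; ring
  rw [hdiv]
  refine hmain.trans (add_le_add ?_ le_rfl)
  have heR : (0 : ℝ) < e := by exact_mod_cast he
  have hmR : (0 : ℝ) < m := by exact_mod_cast hm
  have hD1 : (1 : ℝ) ≤ |(D : ℝ)| := by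
    rw [← Int.cast_abs]; exact_mod_cast Int.one_le_abs hD
  have hU0 : U ≠ 0 := by
    rintro rfl; simp at hdet0
  set α := √(sqNorm U : ℝ) with hα
  set β := √(sqNorm V : ℝ) with hβ
  have hαβ : α ≤ β := Real.sqrt_le_sqrt (by exact_mod_cast hle)
  have hα0 : 0 ≤ α := Real.sqrt_nonneg _
  have hsq : ∀ w : ℤ × ℤ, |(w.1 : ℝ)| ≤ √(sqNorm w : ℝ) ∧ |(w.2 : ℝ)| ≤ √(sqNorm w : ℝ) := by
    intro w
    constructor <;> refine Real.abs_le_sqrt ?_ <;> simp only [sqNorm] <;> push_cast <;>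
      nlinarith [sq_nonneg (w.1 : ℝ), sq_nonneg (w.2 : ℝ)]
  have hprod : α * β ≤ 2 * m := by
    rw [hα, hβ, ← Real.sqrt_mul (by exact_mod_cast (sqNorm_pos hU0).le)]
    refine Real.sqrt_le_iff.2 ⟨by positivity, ?_⟩
    have : (3 : ℝ) * (sqNorm U * sqNorm V) ≤ 4 * (m : ℝ) ^ 2 := by exact_mod_cast hr
    nlinarith [sq_nonneg (m : ℝ)]
  -- The multiple e U lies in the level n lattice, so one bound `ℓ` at level n serves every e.
  -- Together with αβ ≤ 2m it bounds the long vector V.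
  have hℓα : ℓ ≤ e * α := by
    have h1 := hmin ((e : ℤ) • U) (smul_ne_zero he0 hU0) (by
      obtain ⟨k, hk⟩ := (hUV.1 U).2 ⟨1, 0, by simp⟩
      refine ⟨k, ?_⟩
      simp only [Prod.smul_fst, Prod.smul_snd, smul_eq_mul]
      push_cast
      linear_combination (e : ℤ) * hk)
    have h2 : ((sqNorm ((e : ℤ) • U) : ℤ) : ℝ) = (e * α) ^ 2 := by
      rw [mul_pow, hα, Real.sq_sqrt (by exact_mod_cast (sqNorm_pos hU0).le)]
      simp only [sqNorm, Prod.smul_fst, Prod.smul_snd, smul_eq_mul]; push_cast; ring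
    rw [h2] at h1
    exact le_of_sq_le_sq h1 (by positivity)
  have hS : |((((D * e) • U).1 : ℤ) : ℝ)| + |((((D * e) • U).2 : ℤ) : ℝ)| +
      |((((D * e) • V).1 : ℤ) : ℝ)| + |((((D * e) • V).2 : ℤ) : ℝ)| ≤ |(D : ℝ)| * e * (4 * β) := by
    simp only [Prod.smul_fst, Prod.smul_snd, smul_eq_mul]
    push_cast
    simp only [abs_mul, Nat.abs_cast]
    have : |(U.1 : ℝ)| + |(U.2 : ℝ)| + |(V.1 : ℝ)| + |(V.2 : ℝ)| ≤ 4 * β := by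
      linarith [(hsq U).1, (hsq U).2, (hsq V).1, (hsq V).2]
    calc _ = |(D : ℝ)| * e * (|(U.1 : ℝ)| + |(U.2 : ℝ)| + |(V.1 : ℝ)| + |(V.2 : ℝ)|) := by ring
      _ ≤ _ := by gcongr
  rw [div_le_div_iff₀ (by positivity) hℓ]
  calc _ ≤ M * (|(D : ℝ)| * e * (4 * β)) * (e * α) := by gcongr
    _ = M * |(D : ℝ)| * e ^ 2 * 4 * (α * β) := by ring
    _ ≤ M * |(D : ℝ)| * e ^ 2 * 4 * (2 * m) := by gcongr
    _ = 8 * M * (|(D : ℝ)| * e ^ 2 * m) := by ring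
    _ ≤ 8 * M * (|(D : ℝ)| ^ 2 * e ^ 2 * m) := by
        gcongr
        nlinarith
    _ = _ := by rw [sq_abs]

end LevelDist

/-! ### Arithmetic of a single form. -/

namespace BinForm

/-- Modulo a divisor of x₁ - A x₂ it gives q(x) ≡ x₂² q(A, 1), so a root A forces divisibility of q
at every point of its lattice, whether or not x₂ is invertible. -/
lemma eval_sub_sq_mul_eval (q : BinForm) (x : ℤ × ℤ) (A : ℤ) :
    q.eval x - x.2 ^ 2 * q.eval (A, 1) =
      (x.1 - A * x.2) * (q.a * (x.1 + A * x.2) + 2 * q.b * x.2) := by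
  simp only [eval]; ring

/-- On the line `x₁ ≡ A x₂`, divisibility of a value of the form is decided at `(A, 1)`. -/
lemma dvd_eval_iff (q : BinForm) {x : ℤ × ℤ} {A d : ℤ} (hA : d ∣ x.1 - A * x.2)
    (hd : IsCoprime d x.2) : d ∣ q.eval x ↔ d ∣ q.eval (A, 1) := by
  have h1 : d ∣ q.eval x - x.2 ^ 2 * q.eval (A, 1) := by
    rw [eval_sub_sq_mul_eval]; exact hA.mul_right _
  rw [← dvd_iff_dvd_of_dvd_sub h1 |>.symm]
  exact ⟨fun h => (IsCoprime.pow_right hd).dvd_of_dvd_mul_left h, fun h => h.mul_left _⟩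

lemma dehom_eval (q : BinForm) (A : ℤ) : q.dehom.eval A = q.eval (A, 1) := by
  simp [dehom, eval]

/-- The resultant is a combination of the two dehomogenised forms with coefficients in ℤ[Y]. -/
lemma dvd_res {q r : BinForm} {p A : ℤ} (hq : p ∣ q.eval (A, 1)) (hr : p ∣ r.eval (A, 1)) :
    p ∣ q.res r := by
  have hdeg : ∀ q : BinForm, q.dehom.natDegree ≤ 2 := fun q => Polynomial.natDegree_quadratic_le
  obtain ⟨u, v, -, -, h⟩ := Polynomial.exists_mul_add_mul_eq_C_resultant q.dehom r.dehom
    (hdeg q) (hdeg r) (Or.inl two_ne_zero)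
  have h' := congrArg (Polynomial.eval A) h
  simp only [Polynomial.eval_add, Polynomial.eval_mul, dehom_eval, Polynomial.eval_C] at h'
  rw [res, ← h']
  exact dvd_add (hq.mul_right _) (hr.mul_right _)

/-- A root of the form modulo `d` is determined by its greatest common divisor with `d` after
subtracting a fixed root. -/
lemma dvd_sub_of_gcd_eq (q : BinForm) {d : ℕ} (hd : 0 < d) (ha : IsCoprime (d : ℤ) q.a)
    (hδ : IsCoprime (d : ℤ) q.disc) {A A' A₀ : ℤ} (hA : (d : ℤ) ∣ q.eval (A, 1))
    (hA' : (d : ℤ) ∣ q.eval (A', 1)) (hA₀ : (d : ℤ) ∣ q.eval (A₀, 1))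
    (hg : Int.gcd (A - A₀) d = Int.gcd (A' - A₀) d) : (d : ℤ) ∣ A - A' := by
  set u := Int.gcd (A - A₀) d with hu
  have hu0 : 0 < u := Int.gcd_pos_of_ne_zero_right _ (by exact_mod_cast hd.ne')
  have hud : (u : ℤ) ∣ d := Int.gcd_dvd_right _ _
  obtain ⟨w, hw⟩ := hud
  -- Subtracting the two root congruences gives d ∣ (B - A₀)(a(B + A₀) + 2b). After the gcd u is
  -- removed, the cofactor w is coprime to (B - A₀)/u and must divide the second factor.
  have key : ∀ B : ℤ, (d : ℤ) ∣ q.eval (B, 1) → u = Int.gcd (B - A₀) d →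
      w ∣ q.a * (B + A₀) + 2 * q.b := by
    intro B hB hBu
    have h1 : (d : ℤ) ∣ (B - A₀) * (q.a * (B + A₀) + 2 * q.b) := by
      have e : (B - A₀) * (q.a * (B + A₀) + 2 * q.b) = q.eval (B, 1) - q.eval (A₀, 1) := by
        simp only [eval]; ring
      rw [e]
      exact dvd_sub hB hA₀
    obtain ⟨s, hs⟩ : (u : ℤ) ∣ B - A₀ := hBu ▸ Int.gcd_dvd_left _ _
    have hu0' : (u : ℤ) ≠ 0 := by exact_mod_cast hu0.ne'
    have hcop : IsCoprime w s := by
      have h2 : Int.gcd (B - A₀) d = u * Int.gcd s w := by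
        rw [hs, hw, Int.gcd_mul_left, Int.natAbs_natCast]
      rw [← hBu] at h2
      rw [isCoprime_comm, Int.isCoprime_iff_gcd_eq_one]
      exact Nat.eq_of_mul_eq_mul_left hu0 (by omega)
    rw [hs, hw, mul_assoc] at h1
    exact hcop.dvd_of_dvd_mul_left ((mul_dvd_mul_iff_left hu0').1 h1)
  have hwA := key A hA rfl
  have hwA' := key A' hA' hg
  have huA : (u : ℤ) ∣ A - A₀ := Int.gcd_dvd_left _ _
  have huA' : (u : ℤ) ∣ A' - A₀ := hg ▸ Int.gcd_dvd_left _ _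
  have hd0 : (d : ℤ) ≠ 0 := by exact_mod_cast hd.ne'
  -- A prime dividing both u and w would divide 2aA + 2b, whose square is the discriminant plus 4a
  -- q(A, 1), so it would divide the discriminant.
  have huw : IsCoprime (u : ℤ) w := by
    refine isCoprime_of_prime_dvd (fun h => ?_) fun p hp hpu hpw => ?_
    · rw [h.1, zero_mul] at hw; exact hd0 hw
    · have hpd : p ∣ (d : ℤ) := hw ▸ hpu.mul_right _
      have hpδ : p ∣ q.disc := by
        have e : q.disc = (q.a * (A - A₀) + (q.a * (A + A₀) + 2 * q.b)) ^ 2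
            - 4 * q.a * q.eval (A, 1) := by
          simp only [disc, discrim, eval]; ring
        rw [e]
        exact dvd_sub (dvd_pow (dvd_add ((hpu.trans huA).mul_left _) (hpw.trans hwA)) two_ne_zero)
          ((hpd.trans hA).mul_left _)
      exact hp.not_isUnit (hδ.isUnit_of_dvd' hpd hpδ)
  rw [hw]
  refine huw.mul_dvd ?_ ?_
  · have := dvd_sub huA huA'
    simpa using this
  · have h1 : w ∣ q.a * (A - A') := by
      have e : q.a * (A - A') = (q.a * (A + A₀) + 2 * q.b) - (q.a * (A' + A₀) + 2 * q.b) := by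
        ring
      rw [e]
      exact dvd_sub hwA hwA'
    have hwa : IsCoprime w q.a := ha.of_isCoprime_of_dvd_left (hw ▸ dvd_mul_left _ _)
    exact hwa.dvd_of_dvd_mul_left h1

/-- An irreducible form with `a c ≠ 0` has no nontrivial integer zero. -/
lemma eval_ne_zero {q : BinForm} (hq : Irreducible q.toPoly) (ha : q.a ≠ 0) (hc : q.c ≠ 0)
    {x : ℤ × ℤ} (hx : x ≠ 0) : q.eval x ≠ 0 := by
  intro h0
  obtain ⟨g, p, r, hg, hpr, e1, e2⟩ : ∃ g p r : ℤ, g ≠ 0 ∧ IsCoprime p r ∧ x.1 = g * p ∧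
      x.2 = g * r := by
    have hg : 0 < Int.gcd x.1 x.2 := by
      rw [Int.gcd_pos_iff]
      by_contra! h
      exact hx (Prod.ext h.1 h.2)
    refine ⟨Int.gcd x.1 x.2, x.1 / Int.gcd x.1 x.2, x.2 / Int.gcd x.1 x.2, by exact_mod_cast hg.ne',
      ?_, (Int.mul_ediv_cancel' (Int.gcd_dvd_left _ _)).symm,
      (Int.mul_ediv_cancel' (Int.gcd_dvd_right _ _)).symm⟩
    rw [Int.isCoprime_iff_gcd_eq_one]
    exact Int.gcd_ediv_gcd_ediv_gcd hg
  have h1 : q.a * p ^ 2 + 2 * q.b * p * r + q.c * r ^ 2 = 0 := by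
    have : g ^ 2 * (q.a * p ^ 2 + 2 * q.b * p * r + q.c * r ^ 2) = 0 := by
      rw [← h0]; simp only [eval, e1, e2]; ring
    exact (mul_eq_zero.1 this).resolve_left (pow_ne_zero _ hg)
  have hr0 : r ≠ 0 := by
    rintro rfl
    have : p = 0 := by simpa [ha] using h1
    subst this
    exact not_isCoprime_zero_zero hpr
  have hp0 : p ≠ 0 := by
    rintro rfl
    have : r = 0 := by simpa [hc] using h1
    exact hr0 this
  -- Rational root theorem: coprimality of p and r makes the cofactor of the linear form r x - p y
  -- integral, so a zero would factor q over ℤ.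
  obtain ⟨α, hα⟩ : r ∣ q.a := by
    have : r ∣ p ^ 2 * q.a := ⟨-(2 * q.b * p + q.c * r), by linear_combination h1⟩
    exact (hpr.symm.pow_right).dvd_of_dvd_mul_left this
  obtain ⟨β, hβ⟩ : p ∣ q.c := by
    have : p ∣ r ^ 2 * q.c := ⟨-(q.a * p + 2 * q.b * r), by linear_combination h1⟩
    exact (hpr.pow_right).dvd_of_dvd_mul_left this
  have hb : 2 * q.b = -(β * r) - α * p := by
    have : p * r * (2 * q.b + β * r + α * p) = 0 := by
      rw [hα, hβ] at h1; linear_combination h1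
    have := (mul_eq_zero.1 this).resolve_left (mul_ne_zero hp0 hr0)
    linarith
  have hfac : q.toPoly = (MvPolynomial.C r * MvPolynomial.X 0 - MvPolynomial.C p * MvPolynomial.X 1)
      * (MvPolynomial.C α * MvPolynomial.X 0 - MvPolynomial.C β * MvPolynomial.X 1) := by
    rw [toPoly, hb, hα, hβ]
    simp only [map_sub, map_mul, map_neg]
    ring
  -- A linear form vanishes at the origin, where a unit takes a unit value.
  have hnu : ∀ s t : ℤ, ¬ IsUnit (MvPolynomial.C s * MvPolynomial.X 0
      - MvPolynomial.C t * MvPolynomial.X 1 : MvPolynomial (Fin 2) ℤ) := by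
    intro s t hu
    have := hu.map (MvPolynomial.eval (fun _ : Fin 2 => (0 : ℤ)))
    simp at this
  rcases hq.isUnit_or_isUnit hfac with h | h
  · exact hnu _ _ h
  · exact hnu _ _ h

end BinForm

/-! ### Resolving Λ*_d over roots and Möbius inversion. -/

namespace LevelDist
open MeasureTheory Set

variable {g : ℕ} {q : Fin g → BinForm}

lemma a_dvd_bigD (i : Fin g) : (q i).a ∣ bigD q := by
  refine Dvd.dvd.mul_right (Dvd.dvd.mul_left ?_ _) _
  refine dvd_trans ?_ (Finset.dvd_prod_of_mem _ (Finset.mem_univ i))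
  exact (dvd_mul_right _ _).mul_right _

lemma c_dvd_bigD (i : Fin g) : (q i).c ∣ bigD q := by
  refine Dvd.dvd.mul_right (Dvd.dvd.mul_left ?_ _) _
  refine dvd_trans ?_ (Finset.dvd_prod_of_mem _ (Finset.mem_univ i))
  exact (dvd_mul_left _ _).mul_right _

lemma disc_dvd_bigD (i : Fin g) : (q i).disc ∣ bigD q := by
  refine Dvd.dvd.mul_right (Dvd.dvd.mul_left ?_ _) _
  refine dvd_trans ?_ (Finset.dvd_prod_of_mem _ (Finset.mem_univ i))
  exact dvd_mul_left _ _

lemma res_dvd_bigD {i j : Fin g} (hij : i < j) : (q i).res (q j) ∣ bigD q := by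
  refine Dvd.dvd.mul_left ?_ _
  refine dvd_trans ?_ (Finset.dvd_prod_of_mem _ (Finset.mem_univ i))
  exact Finset.dvd_prod_of_mem (fun j => (q i).res (q j)) (Finset.mem_Ioi.2 hij)

/-- The common roots `A` modulo `d₁ ⋯ d_g` of the congruences `q_i(A, 1) ≡ 0 (mod d_i)`. -/
noncomputable def rootSet (q : Fin g → BinForm) (d : Fin g → ℕ) : Finset ℕ :=
  (Finset.range (∏ i, d i)).filter fun A => ∀ i, (d i : ℤ) ∣ (q i).eval ((A : ℤ), 1)

lemma natCast_dvd_prod (d : Fin g → ℕ) (i : Fin g) : (d i : ℤ) ∣ ((∏ i, d i : ℕ) : ℤ) :=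
  Int.natCast_dvd_natCast.2 (Finset.dvd_prod_of_mem _ (Finset.mem_univ i))

/-- A common divisor of d_i and d_j divides both forms at (A, 1), hence their resultant, hence D.
This is why the resultants enter D. -/
lemma pairwise_coprime_of_root {d : Fin g → ℕ} (hd : ∀ i, IsCoprime (d i : ℤ) (bigD q)) {A : ℤ}
    (hA : ∀ i, (d i : ℤ) ∣ (q i).eval (A, 1)) {i j : Fin g} (hij : i ≠ j) :
    IsCoprime (d i : ℤ) (d j) := by
  wlog h : i < j generalizing i j
  · exact (this hij.symm (lt_of_le_of_ne (not_lt.1 h) hij.symm)).symm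
  by_contra hcon
  rw [Int.isCoprime_iff_gcd_eq_one] at hcon
  have h1 : ((Int.gcd (d i : ℤ) (d j) : ℕ) : ℤ) ∣ bigD q :=
    (BinForm.dvd_res ((Int.gcd_dvd_left _ _).trans (hA i))
      ((Int.gcd_dvd_right _ _).trans (hA j))).trans (res_dvd_bigD h)
  have h2 := (hd i).isUnit_of_dvd' (Int.gcd_dvd_left (d i : ℤ) (d j)) h1
  rw [Int.isUnit_iff_natAbs_eq, Int.natAbs_natCast] at h2
  exact hcon h2

/-- Relative to a fixed root A₀, a root A is determined by the tuple gcd(A - A₀, d_i) of divisors of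
the d_i. The argument treats prime powers like primes and needs no Hensel lifting. -/
lemma card_rootSet_le {d : Fin g → ℕ} (hpos : ∀ i, 0 < d i)
    (hd : ∀ i, IsCoprime (d i : ℤ) (bigD q)) :
    (rootSet q d).card ≤ ∏ i, (d i).divisors.card := by
  rcases (rootSet q d).eq_empty_or_nonempty with h | ⟨A₀, hA₀⟩
  · simp [h]
  have hA₀' := (Finset.mem_filter.1 hA₀).2
  rw [← Fintype.card_piFinset]
  refine Finset.card_le_card_of_injOn (fun A i => Int.gcd ((A : ℤ) - A₀) (d i)) ?_ ?_
  · intro A _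
    simp only [Finset.mem_coe, Fintype.mem_piFinset, Nat.mem_divisors]
    exact fun i => ⟨Int.natCast_dvd_natCast.1 (Int.gcd_dvd_right _ _), (hpos i).ne'⟩
  · intro A hA A' hA' heq
    obtain ⟨hAr, hA⟩ := Finset.mem_filter.1 (Finset.mem_coe.1 hA)
    obtain ⟨hAr', hA'⟩ := Finset.mem_filter.1 (Finset.mem_coe.1 hA')
    have h1 : ∀ i, (d i : ℤ) ∣ (A : ℤ) - A' := fun i =>
      BinForm.dvd_sub_of_gcd_eq (q i) (hpos i) ((hd i).of_isCoprime_of_dvd_right (a_dvd_bigD i))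
        ((hd i).of_isCoprime_of_dvd_right (disc_dvd_bigD i)) (hA i) (hA' i) (hA₀' i)
        (congrFun heq i)
    have h2 : ((∏ i, d i : ℕ) : ℤ) ∣ (A : ℤ) - A' := by
      push_cast
      exact Finset.prod_dvd_of_coprime
        (fun i _ j _ hij => pairwise_coprime_of_root hd hA hij) fun i _ => h1 i
    have h3 : A ≡ A' [MOD ∏ i, d i] := by
      rw [← Int.natCast_modEq_iff]
      exact (Int.modEq_iff_dvd.2 h2).symm
    exact h3.eq_of_lt_of_lt (Finset.mem_range.1 hAr) (Finset.mem_range.1 hAr')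

/-- A prime dividing n and x₂ divides some d_i, hence a_i x₁². It cannot divide a_i, which divides
D, so it divides x₁ and contradicts the gcd condition. -/
lemma isCoprime_snd_of_gcd {d : Fin g → ℕ} (hpos : ∀ i, 0 < d i)
    (hd : ∀ i, IsCoprime (d i : ℤ) (bigD q))
    {x : ℤ × ℤ} (hx : ∀ i, (d i : ℤ) ∣ (q i).eval x)
    (hg : Nat.gcd (Int.gcd x.1 x.2) (∏ i, d i) = 1) :
    IsCoprime ((∏ i, d i : ℕ) : ℤ) x.2 := by
  have hn : ((∏ i, d i : ℕ) : ℤ) ≠ 0 := by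
    exact_mod_cast (Finset.prod_pos fun i _ => hpos i).ne'
  refine isCoprime_of_prime_dvd (fun h => hn h.1) fun p hp hpn hp2 => ?_
  have hpn' := hpn
  push_cast at hpn
  obtain ⟨i, -, hi⟩ := (hp.dvd_finsetProd_iff _).1 hpn
  have h1 : p ∣ (q i).a * x.1 ^ 2 := by
    have h := dvd_sub (hi.trans (hx i)) (hp2.mul_right (2 * (q i).b * x.1 + (q i).c * x.2))
    have e : (q i).eval x - x.2 * (2 * (q i).b * x.1 + (q i).c * x.2) = (q i).a * x.1 ^ 2 := by
      simp only [BinForm.eval]; ring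
    rwa [e] at h
  have h2 : p ∣ x.1 := by
    rcases hp.dvd_or_dvd h1 with h | h
    · exact absurd ((hd i).isUnit_of_dvd' hi (h.trans (a_dvd_bigD i))) hp.not_isUnit
    · exact hp.dvd_of_dvd_pow h
  have h3 : p.natAbs ∣ Nat.gcd (Int.gcd x.1 x.2) (∏ i, d i) :=
    Nat.dvd_gcd (Nat.dvd_gcd (Int.natAbs_dvd_natAbs.2 h2) (Int.natAbs_dvd_natAbs.2 hp2))
      (Int.natAbs_dvd_natAbs.2 hpn')
  rw [hg, Nat.dvd_one] at h3
  exact hp.not_isUnit (Int.isUnit_iff_natAbs_eq.2 h3)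

/-- A point whose second coordinate is invertible lies on some line `x₁ ≡ A x₂`. -/
lemma exists_residue {n : ℕ} (hn : 0 < n) {x : ℤ × ℤ} (hx : IsCoprime (n : ℤ) x.2) :
    ∃ A ∈ Finset.range n, (n : ℤ) ∣ x.1 - (A : ℤ) * x.2 := by
  obtain ⟨a, b, hab⟩ := hx
  have hn0 : (n : ℤ) ≠ 0 := by exact_mod_cast hn.ne'
  have h0 := Int.emod_nonneg (b * x.1) hn0
  have h1 := Int.emod_lt_of_pos (b * x.1) (by exact_mod_cast hn : (0 : ℤ) < n)
  refine ⟨((b * x.1) % n).toNat, Finset.mem_range.2 (by omega), ?_⟩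
  rw [Int.toNat_of_nonneg h0, Int.emod_def]
  exact ⟨x.1 * a + (b * x.1 / n) * x.2, by linear_combination (-x.1) * hab⟩

lemma residue_unique {n : ℕ} {x : ℤ × ℤ} (hx : IsCoprime (n : ℤ) x.2) {A A' : ℕ}
    (hA : A ∈ Finset.range n) (hA' : A' ∈ Finset.range n) (h : (n : ℤ) ∣ x.1 - (A : ℤ) * x.2)
    (h' : (n : ℤ) ∣ x.1 - (A' : ℤ) * x.2) : A = A' := by
  have h1 : (n : ℤ) ∣ ((A' : ℤ) - A) * x.2 := by
    have := dvd_sub h h'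
    have e : x.1 - (A : ℤ) * x.2 - (x.1 - (A' : ℤ) * x.2) = ((A' : ℤ) - A) * x.2 := by ring
    rwa [e] at this
  have h2 := hx.dvd_of_dvd_mul_right h1
  have h3 : A ≡ A' [MOD n] := by
    rw [← Int.natCast_modEq_iff]
    exact Int.modEq_iff_dvd.2 h2
  exact h3.eq_of_lt_of_lt (Finset.mem_range.1 hA) (Finset.mem_range.1 hA')

lemma mem_rootSet_of_dvd {d : Fin g → ℕ} {x : ℤ × ℤ} (hx : ∀ i, (d i : ℤ) ∣ (q i).eval x)
    (hc : IsCoprime ((∏ i, d i : ℕ) : ℤ) x.2) {A : ℕ} (hA : A ∈ Finset.range (∏ i, d i))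
    (hdvd : ((∏ i, d i : ℕ) : ℤ) ∣ x.1 - (A : ℤ) * x.2) : A ∈ rootSet q d :=
  Finset.mem_filter.2 ⟨hA, fun i => ((q i).dvd_eval_iff ((natCast_dvd_prod d i).trans hdvd)
    (hc.of_isCoprime_of_dvd_left (natCast_dvd_prod d i))).1 (hx i)⟩

lemma sum_moebius_ite_dvd {n : ℕ} (hn : 0 < n) (k : ℤ) :
    ∑ e ∈ n.divisors, (if (e : ℤ) ∣ k then ArithmeticFunction.moebius e else 0)
      = if IsCoprime (n : ℤ) k then 1 else 0 := by
  rw [← Finset.sum_filter]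
  have h1 : n.divisors.filter (fun e : ℕ => (e : ℤ) ∣ k) = (Int.gcd n k).divisors := by
    ext e
    have hg : Int.gcd n k ≠ 0 := (Int.gcd_pos_of_ne_zero_left _ (by exact_mod_cast hn.ne')).ne'
    simp only [Finset.mem_filter, Nat.mem_divisors]
    constructor
    · rintro ⟨⟨h1, -⟩, h2⟩
      exact ⟨Nat.dvd_gcd (by simpa using h1) (Int.natCast_dvd.1 h2), hg⟩
    · rintro ⟨h, -⟩
      have h' : (e : ℤ) ∣ (Int.gcd n k : ℕ) := Int.natCast_dvd_natCast.2 h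
      exact ⟨⟨Int.natCast_dvd_natCast.1 (h'.trans (Int.gcd_dvd_left _ _)), hn.ne'⟩,
        h'.trans (Int.gcd_dvd_right _ _)⟩
  simp only [h1, Int.isCoprime_iff_gcd_eq_one]
  have h2 := congrArg (fun f => f (Int.gcd n k)) ArithmeticFunction.moebius_mul_coe_zeta
  rwa [ArithmeticFunction.coe_mul_zeta_apply, ArithmeticFunction.one_apply] at h2

open scoped Classical in
/-- The indicator function of `Λ*_d`, resolved over the roots and by Möbius inversion. -/
lemma indicator_lamStar {d : Fin g → ℕ} (hpos : ∀ i, 0 < d i)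
    (hd : ∀ i, IsCoprime (d i : ℤ) (bigD q)) (x : ℤ × ℤ) :
    (if x ∈ lamStar q d then (1 : ℤ) else 0) =
      ∑ A ∈ rootSet q d, ∑ e ∈ (∏ i, d i).divisors, ArithmeticFunction.moebius e *
        if ((∏ i, d i : ℕ) : ℤ) ∣ x.1 - (A : ℤ) * x.2 ∧ (e : ℤ) ∣ x.2 then 1 else 0 := by
  have hn : 0 < ∏ i, d i := Finset.prod_pos fun i _ => hpos i
  have hinner : ∀ A : ℕ, ∑ e ∈ (∏ i, d i).divisors, ArithmeticFunction.moebius e *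
        (if ((∏ i, d i : ℕ) : ℤ) ∣ x.1 - (A : ℤ) * x.2 ∧ (e : ℤ) ∣ x.2 then 1 else 0) =
      if ((∏ i, d i : ℕ) : ℤ) ∣ x.1 - (A : ℤ) * x.2 ∧ IsCoprime ((∏ i, d i : ℕ) : ℤ) x.2
        then 1 else 0 := by
    intro A
    by_cases h : ((∏ i, d i : ℕ) : ℤ) ∣ x.1 - (A : ℤ) * x.2
    · simp only [h, true_and, mul_ite, mul_one, mul_zero]
      exact sum_moebius_ite_dvd hn x.2
    · simp only [h, false_and, if_false, mul_zero, Finset.sum_const_zero]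
  simp only [hinner]
  by_cases hx : x ∈ lamStar q d
  · rw [if_pos hx]
    have hc := isCoprime_snd_of_gcd hpos hd hx.1 hx.2
    obtain ⟨A, hA, hdvd⟩ := exists_residue hn hc
    rw [Finset.sum_eq_single_of_mem A (mem_rootSet_of_dvd hx.1 hc hA hdvd)]
    · rw [if_pos ⟨hdvd, hc⟩]
    · intro B hB hBA
      exact if_neg fun h => hBA (residue_unique hc (Finset.mem_filter.1 hB).1 hA h.1 hdvd)
  · rw [if_neg hx]
    refine (Finset.sum_eq_zero fun A hA => if_neg fun h => hx ⟨fun i => ?_, ?_⟩).symm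
    · exact ((q i).dvd_eval_iff ((natCast_dvd_prod d i).trans h.1)
        (h.2.of_isCoprime_of_dvd_left (natCast_dvd_prod d i))).2 ((Finset.mem_filter.1 hA).2 i)
    · have h1 := Int.isCoprime_iff_gcd_eq_one.1 h.2
      have h2 : Nat.gcd (Int.gcd x.1 x.2) (∏ i, d i) ∣ Int.gcd ((∏ i, d i : ℕ) : ℤ) x.2 :=
        Nat.dvd_gcd (Nat.gcd_dvd_right _ (∏ i, d i))
          ((Nat.gcd_dvd_left _ _).trans (Nat.gcd_dvd_right _ _))
      rwa [h1, Nat.dvd_one] at h2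

open scoped Classical in
/-- Counting points of `Λ*_d` in a finite set. -/
lemma ncard_lamStar_inter {d : Fin g → ℕ} (hpos : ∀ i, 0 < d i)
    (hd : ∀ i, IsCoprime (d i : ℤ) (bigD q)) {T : Set (ℤ × ℤ)} (hT : T.Finite) :
    (((lamStar q d ∩ T).ncard : ℕ) : ℤ) =
      ∑ A ∈ rootSet q d, ∑ e ∈ (∏ i, d i).divisors, ArithmeticFunction.moebius e *
        (({x : ℤ × ℤ | ((∏ i, d i : ℕ) : ℤ) ∣ x.1 - (A : ℤ) * x.2 ∧ (e : ℤ) ∣ x.2} ∩ T).ncard : ℕ)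
      := by
  have hcount : ∀ S : Set (ℤ × ℤ), (((S ∩ T).ncard : ℕ) : ℤ)
      = ∑ x ∈ hT.toFinset, if x ∈ S then 1 else 0 := by
    intro S
    rw [Finset.sum_boole, ← Set.ncard_coe_finset]
    congr 2
    ext x
    simp [and_comm]
  simp only [hcount, indicator_lamStar hpos hd, Finset.mul_sum]
  rw [Finset.sum_comm]
  refine Finset.sum_congr rfl fun A _ => ?_
  rw [Finset.sum_comm]
  refine Finset.sum_congr rfl fun e _ => Finset.sum_congr rfl fun x _ => ?_
  congr

/-- Points of the lattice `x₁ ≡ A x₂ (mod n)` with `e ∣ x₂` in the box `[0, n)²`. -/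
lemma ncard_congruence_box {n e : ℕ} (hn : 0 < n) (hen : e ∣ n) (A : ℤ) :
    ({x : ℤ × ℤ | (n : ℤ) ∣ x.1 - A * x.2 ∧ (e : ℤ) ∣ x.2} ∩
      (Set.Ico 0 (n : ℤ) ×ˢ Set.Ico 0 (n : ℤ))).ncard = n / e := by
  obtain ⟨m, rfl⟩ := hen
  have he : 0 < e := Nat.pos_of_mul_pos_right hn
  have hm : 0 < m := Nat.pos_of_mul_pos_left hn
  have hn0 : ((e * m : ℕ) : ℤ) ≠ 0 := by exact_mod_cast hn.ne'
  have hn' : (0 : ℤ) < ((e * m : ℕ) : ℤ) := by exact_mod_cast hn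
  rw [Nat.mul_div_cancel_left _ he]
  set f : ℕ → ℤ × ℤ := fun j => ((A * (e * j)) % ((e * m : ℕ) : ℤ), (e : ℤ) * j) with hf
  have hinj : Function.Injective f := by
    intro i j hij
    have := (Prod.ext_iff.1 hij).2
    simp only [hf] at this
    have he' : (e : ℤ) ≠ 0 := by exact_mod_cast he.ne'
    exact_mod_cast mul_left_cancel₀ he' this
  have : {x : ℤ × ℤ | ((e * m : ℕ) : ℤ) ∣ x.1 - A * x.2 ∧ (e : ℤ) ∣ x.2} ∩
      (Set.Ico 0 ((e * m : ℕ) : ℤ) ×ˢ Set.Ico 0 ((e * m : ℕ) : ℤ))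
      = f '' (Finset.range m : Set ℕ) := by
    ext x
    simp only [Set.mem_inter_iff, Set.mem_ofPred_eq, Set.mem_prod, Set.mem_Ico, Set.mem_image,
      Finset.coe_range, Set.mem_Iio]
    constructor
    · rintro ⟨⟨h1, ⟨k, hk⟩⟩, ⟨h2, h3⟩, h4, h5⟩
      have he' : (0 : ℤ) < e := by exact_mod_cast he
      have hk0 : 0 ≤ k := by
        by_contra! h; nlinarith
      have hkm : k < m := by
        rw [hk] at h5; push_cast at h5
        exact lt_of_mul_lt_mul_left h5 he'.le
      refine ⟨k.toNat, by omega, Prod.ext ?_ ?_⟩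
      · simp only [hf, Int.toNat_of_nonneg hk0]
        rw [← hk]
        have : x.1 % ((e * m : ℕ) : ℤ) = (A * x.2) % ((e * m : ℕ) : ℤ) :=
          (Int.modEq_iff_dvd.2 h1).symm
        rw [← this, Int.emod_eq_of_lt h2 h3]
      · simp only [hf, Int.toNat_of_nonneg hk0, hk]
    · rintro ⟨j, hj, rfl⟩
      refine ⟨⟨?_, dvd_mul_right _ _⟩, ⟨Int.emod_nonneg _ hn0, Int.emod_lt_of_pos _ hn'⟩,
        by positivity, ?_⟩
      · exact Int.modEq_iff_dvd.1 (Int.mod_modEq _ _).symm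
      · simp only [hf]
        exact_mod_cast Nat.mul_lt_mul_of_pos_left hj he
  rw [this, Set.ncard_image_of_injective _ hinj, Set.ncard_coe_finset, Finset.card_range]

lemma finite_preimage_toPlane {R : Set (EuclideanSpace ℝ (Fin 2))} (hR : Bornology.IsBounded R) :
    (toPlane ⁻¹' R).Finite := by
  obtain ⟨r, hr⟩ := hR.subset_closedBall 0
  refine ((Set.finite_Icc (-⌈r⌉) ⌈r⌉).prod (Set.finite_Icc (-⌈r⌉) ⌈r⌉)).subset fun x hx => ?_
  have h1 : ‖toPlane x‖ ≤ r := by simpa using hr hx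
  have h2 : ∀ i, |toPlane x i| ≤ ⌈r⌉ := fun i => by
    rw [← Real.norm_eq_abs]
    exact (PiLp.norm_apply_le _ i).trans (h1.trans (Int.le_ceil r))
  have h3 := h2 0
  have h4 := h2 1
  simp only [toPlane, Matrix.cons_val_zero, Matrix.cons_val_one] at h3 h4
  rw [← Int.cast_abs, Int.cast_le, abs_le] at h3 h4
  exact ⟨h3, h4⟩

/-! ### Discrepancy of one modulus in terms of shortest vectors. -/

/-- The supremum norm of an integer vector. -/
def height (w : ℤ × ℤ) : ℕ := max w.1.natAbs w.2.natAbs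

lemma height_sq_le_sqNorm (w : ℤ × ℤ) : (height w : ℤ) ^ 2 ≤ sqNorm w := by
  unfold height sqNorm
  rcases max_choice w.1.natAbs w.2.natAbs with h | h <;> rw [h, Int.natCast_natAbs, sq_abs] <;>
    nlinarith [sq_nonneg w.1, sq_nonneg w.2]

lemma height_pos {w : ℤ × ℤ} (hw : w ≠ 0) : 0 < height w := by
  by_contra h
  have h' : max w.1.natAbs w.2.natAbs = 0 := by unfold height at h; omega
  exact hw (Prod.ext (by simp; omega) (by simp; omega))

/-- A chosen shortest nonzero vector of the lattice `w₁ ≡ A w₂ (mod n)`. -/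
noncomputable def shortVec (n : ℕ) (A : ℤ) : ℤ × ℤ :=
  if h : 0 < n then (exists_shortest h A).choose else 0

lemma shortVec_spec {n : ℕ} (hn : 0 < n) (A : ℤ) :
    shortVec n A ≠ 0 ∧ (n : ℤ) ∣ (shortVec n A).1 - A * (shortVec n A).2 ∧
      sqNorm (shortVec n A) ≤ 2 * n ∧
      ∀ w : ℤ × ℤ, w ≠ 0 → (n : ℤ) ∣ w.1 - A * w.2 → sqNorm (shortVec n A) ≤ sqNorm w := by
  rw [shortVec, dif_pos hn]
  exact (exists_shortest hn A).choose_spec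

/-- The discrepancy of a single modulus in terms of shortest vectors. -/
theorem discrepancyStar_le (hD : bigD q ≠ 0) {d : Fin g → ℕ} (hpos : ∀ i, 0 < d i)
    (hd : ∀ i, IsCoprime (d i : ℤ) (bigD q)) (z : ℤ × ℤ) {M : ℝ} (hM : 0 ≤ M)
    {R : Set (EuclideanSpace ℝ (Fin 2))} (hR : R ∈ regions M) :
    discrepancyStar q z d R ≤ ∑ A ∈ rootSet q d,
      ((∏ i, d i).divisors.card : ℝ) * (8 * M / height (shortVec (∏ i, d i) A) + 1) := by
  have hn : 0 < ∏ i, d i := Finset.prod_pos fun i _ => hpos i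
  have hnR : (0 : ℝ) < ((∏ i, d i : ℕ) : ℝ) := by exact_mod_cast hn
  have hDR : (bigD q : ℝ) ≠ 0 := by exact_mod_cast hD
  have hnD : IsCoprime ((∏ i, d i : ℕ) : ℤ) (bigD q) := by
    push_cast
    exact IsCoprime.prod_left fun i _ => hd i
  have hfin : (toPlane ⁻¹' R ∩ psiSet (bigD q) z).Finite :=
    (finite_preimage_toPlane hR.2.1).inter_of_left _
  have hbox : (Set.Ico 0 ((∏ i, d i : ℕ) : ℤ) ×ˢ Set.Ico 0 ((∏ i, d i : ℕ) : ℤ)).Finite :=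
    (Set.finite_Ico _ _).prod (Set.finite_Ico _ _)
  have e1 := congrArg (Int.cast : ℤ → ℝ) (ncard_lamStar_inter hpos hd hfin)
  have e2 := congrArg (Int.cast : ℤ → ℝ) (ncard_lamStar_inter hpos hd hbox)
  simp only [← Set.inter_assoc] at e1
  push_cast at e1 e2
  -- Each lattice has n/e points in the box [0, n)². Divided by (nD)² this is 1/(D² n e), exactly
  -- its density within Ψ, so main terms cancel one by one.
  have e2' : (rhoStar q d : ℝ) = ∑ A ∈ rootSet q d, ∑ e ∈ (∏ i, d i).divisors,
      (ArithmeticFunction.moebius e : ℝ) * (((∏ i, d i : ℕ) : ℝ) / e) := by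
    rw [rhoStar]
    push_cast
    rw [e2]
    refine Finset.sum_congr rfl fun A _ => Finset.sum_congr rfl fun e he => ?_
    have hb := ncard_congruence_box hn (Nat.dvd_of_mem_divisors he) (A : ℤ)
    push_cast at hb
    rw [hb, Nat.cast_div (Nat.dvd_of_mem_divisors he)
      (by exact_mod_cast (Nat.pos_of_mem_divisors he).ne')]
    push_cast
    rfl
  rw [discrepancyStar, e1, e2', Finset.sum_div, Finset.sum_mul, ← Finset.sum_sub_distrib]
  refine (Finset.abs_sum_le_sum_abs _ _).trans (Finset.sum_le_sum fun A _ => ?_)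
  rw [Finset.sum_div, Finset.sum_mul, ← Finset.sum_sub_distrib]
  refine (Finset.abs_sum_le_sum_abs _ _).trans ?_
  refine le_trans (Finset.sum_le_card_nsmul _ _ (8 * M / height (shortVec (∏ i, d i) A) + 1)
    fun e he => ?_) (le_of_eq (nsmul_eq_mul _ _))
  have heR : (0 : ℝ) < e := by exact_mod_cast Nat.pos_of_mem_divisors he
  obtain ⟨s1, s2, s3, s4⟩ := shortVec_spec hn (A : ℤ)
  have hmain := abs_ncard_congruence_sub_le hM hR hn (Nat.dvd_of_mem_divisors he) (A : ℤ) hD hnD z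
    (ℓ := height (shortVec (∏ i, d i) A)) (by exact_mod_cast height_pos s1)
    (fun w hw hwA => by
      exact_mod_cast (height_sq_le_sqNorm _).trans (s4 w hw hwA))
  refine le_trans ?_ hmain
  set N : ℝ := ((∏ i, d i : ℕ) : ℝ) with hN
  have hmu : |(ArithmeticFunction.moebius e : ℝ)| ≤ 1 := by
    rw [← Int.cast_abs]; exact_mod_cast ArithmeticFunction.abs_moebius_le_one
  have hfac : ∀ a : ℝ, (ArithmeticFunction.moebius e : ℝ) * a
      - (ArithmeticFunction.moebius e : ℝ) * (N / e) / (N * (bigD q : ℝ)) ^ 2 * (volume R).toReal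
      = (ArithmeticFunction.moebius e : ℝ) *
        (a - (volume R).toReal / ((bigD q : ℝ) ^ 2 * N * e)) := by
    intro a; field_simp
  push_cast [hN] at hfac ⊢
  rw [hfac, abs_mul]
  exact mul_le_of_le_one_left (abs_nonneg _) hmu

/-! ### Divisor function: moments and control by small divisors. -/

lemma card_divisors_mul_le (a b : ℕ) :
    (a * b).divisors.card ≤ a.divisors.card * b.divisors.card := by
  rw [Nat.divisors_mul]
  exact Finset.card_mul_le

lemma card_divisors_prod_le {ι : Type*} (s : Finset ι) (d : ι → ℕ) :
    (∏ i ∈ s, d i).divisors.card ≤ ∏ i ∈ s, (d i).divisors.card := by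
  classical
  induction s using Finset.induction_on with
  | empty => simp
  | insert a s ha ih =>
    rw [Finset.prod_insert ha, Finset.prod_insert ha]
    exact (card_divisors_mul_le _ _).trans (Nat.mul_le_mul_left _ ih)

lemma one_le_card_divisors {n : ℕ} (hn : n ≠ 0) : 1 ≤ n.divisors.card :=
  Finset.card_pos.2 ⟨1, Nat.one_mem_divisors.2 hn⟩

/-- Weighted moments of the divisor function. -/
lemma sum_card_divisors_pow_div_le (B x : ℕ) :
    ∑ m ∈ Finset.Icc 1 x, (m.divisors.card : ℝ) ^ B / m ≤ (1 + Real.log x) ^ (2 ^ B) := by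
  induction B with
  | zero =>
    have h := harmonic_le_one_add_log x
    rw [harmonic_eq_sum_Icc] at h
    push_cast at h
    simpa using h
  | succ B ih =>
    set F : ℕ → ℝ := fun m => (m.divisors.card : ℝ) ^ B / m with hF
    have hF0 : ∀ m, 0 ≤ F m := fun m => by positivity
    -- One factor τ(m) is opened as a sum over factorisations m = p₁p₂, and submultiplicativity
    -- splits the rest. Dropping p₁p₂ ≤ x squares the previous sum, hence the doubling exponent `2 ^
    -- B`.
    have hstep : ∀ m ∈ Finset.Icc 1 x, (m.divisors.card : ℝ) ^ (B + 1) / m ≤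
        ∑ p ∈ ((Finset.Icc 1 x ×ˢ Finset.Icc 1 x).filter
          fun p => p.1 * p.2 ∈ Finset.Icc 1 x).filter fun p => p.1 * p.2 = m, F p.1 * F p.2 := by
      intro m hm
      have hm0 : m ≠ 0 := by have := (Finset.mem_Icc.1 hm).1; omega
      have hset : ((Finset.Icc 1 x ×ˢ Finset.Icc 1 x).filter
          fun p => p.1 * p.2 ∈ Finset.Icc 1 x).filter (fun p => p.1 * p.2 = m)
          = m.divisorsAntidiagonal := by
        ext p
        simp only [Finset.mem_filter, Finset.mem_product, Nat.mem_divisorsAntidiagonal]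
        constructor
        · rintro ⟨-, h⟩; exact ⟨h, hm0⟩
        · rintro ⟨h, -⟩
          have h1 : 0 < p.1 := Nat.pos_of_ne_zero fun h' => hm0 (by rw [← h, h', zero_mul])
          have h2 : 0 < p.2 := Nat.pos_of_ne_zero fun h' => hm0 (by rw [← h, h', mul_zero])
          have hmx := (Finset.mem_Icc.1 hm).2
          refine ⟨⟨⟨Finset.mem_Icc.2 ⟨h1, ?_⟩, Finset.mem_Icc.2 ⟨h2, ?_⟩⟩, h ▸ hm⟩, h⟩
          · exact (Nat.le_mul_of_pos_right _ h2).trans (h ▸ hmx)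
          · exact (Nat.le_mul_of_pos_left _ h1).trans (h ▸ hmx)
      rw [hset]
      have hcard : (m.divisors.card : ℝ) = ∑ p ∈ m.divisorsAntidiagonal, (1 : ℝ) := by
        rw [← Nat.map_div_right_divisors]; simp
      rw [pow_succ, mul_div_right_comm, hcard, Finset.mul_sum, ← hcard]
      refine Finset.sum_le_sum fun p hp => ?_
      obtain ⟨h, -⟩ := Nat.mem_divisorsAntidiagonal.1 hp
      simp only [hF, mul_one]
      rw [← h, div_mul_div_comm, ← mul_pow]
      push_cast
      gcongr
      exact_mod_cast card_divisors_mul_le p.1 p.2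
    calc _ ≤ ∑ m ∈ Finset.Icc 1 x, ∑ p ∈ ((Finset.Icc 1 x ×ˢ Finset.Icc 1 x).filter
          fun p => p.1 * p.2 ∈ Finset.Icc 1 x).filter (fun p => p.1 * p.2 = m), F p.1 * F p.2 :=
          Finset.sum_le_sum hstep
      _ = ∑ p ∈ (Finset.Icc 1 x ×ˢ Finset.Icc 1 x).filter
          (fun p => p.1 * p.2 ∈ Finset.Icc 1 x), F p.1 * F p.2 :=
          Finset.sum_fiberwise_of_maps_to (fun p hp => (Finset.mem_filter.1 hp).2) _
      _ ≤ ∑ p ∈ Finset.Icc 1 x ×ˢ Finset.Icc 1 x, F p.1 * F p.2 :=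
          Finset.sum_le_sum_of_subset_of_nonneg (Finset.filter_subset _ _)
            fun p _ _ => mul_nonneg (hF0 _) (hF0 _)
      _ = (∑ m ∈ Finset.Icc 1 x, F m) * ∑ m ∈ Finset.Icc 1 x, F m := by
          rw [Finset.sum_mul_sum, Finset.sum_product]
      _ ≤ (1 + Real.log x) ^ (2 ^ B) * (1 + Real.log x) ^ (2 ^ B) :=
          mul_self_le_mul_self (Finset.sum_nonneg fun m _ => hF0 m) ih
      _ = _ := by rw [← pow_add]; congr 1; ring

lemma sum_card_divisors_pow_le (B x : ℕ) :
    ∑ m ∈ Finset.Icc 1 x, (m.divisors.card : ℝ) ^ B ≤ x * (1 + Real.log x) ^ (2 ^ B) := by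
  refine le_trans ?_ (mul_le_mul_of_nonneg_left (sum_card_divisors_pow_div_le B x) x.cast_nonneg)
  rw [Finset.mul_sum]
  refine Finset.sum_le_sum fun m hm => ?_
  obtain ⟨h1, h2⟩ := Finset.mem_Icc.1 hm
  have hm0 : (0 : ℝ) < m := by exact_mod_cast h1
  rw [← mul_div_assoc, le_div_iff₀ hm0, mul_comm]
  gcongr

/-- Here r is the number of prime factors of m counted with multiplicity. -/
lemma exists_card_divisors_le_two_pow {y : ℝ} (hy : 0 ≤ y) {m : ℕ} (hm : m ≠ 0)
    (hp : ∀ p, p.Prime → p ∣ m → y ≤ p) :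
    ∃ r : ℕ, m.divisors.card ≤ 2 ^ r ∧ y ^ r ≤ m := by
  induction m using induction_on_primes with
  | zero => exact absurd rfl hm
  | one => exact ⟨0, by simp⟩
  | prime_mul p m hpp ih =>
    have hm0 : m ≠ 0 := fun h => hm (by rw [h, mul_zero])
    obtain ⟨r, h1, h2⟩ := ih hm0 fun s hs hsm => hp s hs (hsm.mul_left _)
    refine ⟨r + 1, ?_, ?_⟩
    · refine (card_divisors_mul_le _ _).trans ?_
      rw [hpp.divisors, Finset.card_pair hpp.one_lt.ne, pow_succ, mul_comm]
      exact Nat.mul_le_mul_right _ h1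
    · rw [pow_succ, mul_comm]
      push_cast
      exact mul_le_mul (hp p hpp (dvd_mul_right _ _)) h2 (by positivity) (by positivity)

/-- The number of divisors of `n` is controlled by a small divisor of `n`. -/
lemma exists_small_divisor (c : ℕ) {y : ℝ} (hy : 2 ≤ y) (k : ℕ) {n : ℕ} (hn : n ≠ 0)
    (h : (n : ℝ) ≤ 2 ^ c * y ^ k) :
    ∃ b, b ∣ n ∧ (b : ℝ) ≤ y ^ 2 ∧ n.divisors.card ≤ 2 ^ c * (2 * b.divisors.card) ^ k := by
  have hy0 : 0 < y := by linarith
  induction k generalizing n with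
  | zero =>
    refine ⟨1, one_dvd _, by push_cast; nlinarith, ?_⟩
    have h' : n ≤ 2 ^ c := by
      have : (n : ℝ) ≤ ((2 ^ c : ℕ) : ℝ) := by simpa using h
      exact_mod_cast this
    simpa using (Nat.card_divisors_le_self n).trans h'
  | succ k ih =>
    -- Take the largest divisor b ≤ y². If b ≥ y, the cofactor loses a factor y and the induction
    -- applies to it; the final divisor is whichever of b and the inductive one has more divisors.
    obtain ⟨b, hb, hbmax⟩ := (n.divisors.filter fun b : ℕ => (b : ℝ) ≤ y ^ 2).exists_max_image id
      ⟨1, Finset.mem_filter.2 ⟨Nat.one_mem_divisors.2 hn, by push_cast; nlinarith⟩⟩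
    obtain ⟨hbn, hby⟩ := Finset.mem_filter.1 hb
    obtain ⟨m, rfl⟩ := Nat.dvd_of_mem_divisors hbn
    have hb0 : b ≠ 0 := left_ne_zero_of_mul hn
    have hm0 : m ≠ 0 := right_ne_zero_of_mul hn
    have hb1 := one_le_card_divisors hb0
    rcases le_or_gt y b with hyb | hyb
    · obtain ⟨b', hb'm, hb'y, hb'⟩ := ih hm0 (by
        have h1 : (b : ℝ) * m ≤ 2 ^ c * y ^ k * y := by
          rw [mul_assoc, ← pow_succ]; exact_mod_cast h
        have h2 : y * m ≤ 2 ^ c * y ^ k * y :=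
          (mul_le_mul_of_nonneg_right hyb m.cast_nonneg).trans h1
        nlinarith)
      have hbm : (b * m).divisors.card ≤ b.divisors.card *
          (2 ^ c * (2 * b'.divisors.card) ^ k) :=
        (card_divisors_mul_le _ _).trans (Nat.mul_le_mul_left _ hb')
      have hfin : ∀ t : ℕ, b.divisors.card ≤ t → b'.divisors.card ≤ t →
          (b * m).divisors.card ≤ 2 ^ c * (2 * t) ^ (k + 1) := by
        intro t h1 h2
        calc _ ≤ _ := hbm
          _ ≤ t * (2 ^ c * (2 * t) ^ k) := by gcongr
          _ ≤ 2 * t * (2 ^ c * (2 * t) ^ k) := by gcongr; omega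
          _ = _ := by ring
      rcases le_total b'.divisors.card b.divisors.card with hle | hle
      · exact ⟨b, dvd_mul_right _ _, hby, hfin _ le_rfl hle⟩
      · exact ⟨b', hb'm.mul_left _, hb'y, hfin _ hle le_rfl⟩
    -- If b < y, a prime p < y of the cofactor would make b p ≤ y² a larger admissible divisor. So
    -- all its primes are at least y, and as y ≥ 2 there are at most c + k + 1 of them.
    · obtain ⟨r, hr1, hr2⟩ := exists_card_divisors_le_two_pow hy0.le hm0 fun p hp hpm => by
        by_contra! hlt
        have hmem : b * p ∈ (b * m).divisors.filter fun b : ℕ => (b : ℝ) ≤ y ^ 2 := by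
          refine Finset.mem_filter.2 ⟨Nat.mem_divisors.2 ⟨Nat.mul_dvd_mul_left _ hpm, hn⟩, ?_⟩
          push_cast
          nlinarith [(b.cast_nonneg : (0 : ℝ) ≤ b), (p.cast_nonneg : (0 : ℝ) ≤ p)]
        have h1 : b * p ≤ b := hbmax _ hmem
        have h2 := hp.two_le
        have h3 : 0 < b := Nat.pos_of_ne_zero hb0
        nlinarith
      have hr : r ≤ c + (k + 1) := by
        by_contra! hlt
        have h1 : (m : ℝ) ≤ 2 ^ c * y ^ (k + 1) := by
          refine le_trans ?_ h
          exact_mod_cast Nat.le_mul_of_pos_left m (Nat.pos_of_ne_zero hb0)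
        have h2 : (2 : ℝ) ^ c * y ^ (k + 1) ≤ y ^ (c + (k + 1)) := by
          rw [pow_add y c (k + 1)]; gcongr
        have h3 : y ^ (c + (k + 1)) < y ^ r := pow_lt_pow_right₀ (by linarith) hlt
        linarith
      refine ⟨b, dvd_mul_right _ _, hby, ?_⟩
      calc _ ≤ b.divisors.card * m.divisors.card := card_divisors_mul_le _ _
        _ ≤ b.divisors.card * 2 ^ (c + (k + 1)) := by
            gcongr
            exact hr1.trans (Nat.pow_le_pow_right two_pos hr)
        _ ≤ b.divisors.card ^ (k + 1) * 2 ^ (c + (k + 1)) := by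
            gcongr
            exact Nat.le_self_pow (by omega) _
        _ = _ := by rw [mul_pow, pow_add]; ring

/-- The divisors of `N` that are coprime to `D`. -/
noncomputable def coprimeDivisors (D N : ℤ) : Finset ℕ :=
  N.natAbs.divisors.filter fun k => IsCoprime (k : ℤ) D

lemma mem_coprimeDivisors {D N : ℤ} (hN : N ≠ 0) {k : ℕ} :
    k ∈ coprimeDivisors D N ↔ (k : ℤ) ∣ N ∧ IsCoprime (k : ℤ) D := by
  simp [coprimeDivisors, Int.natCast_dvd, hN]

/-- The set is closed under lcm, so its maximum m is a multiple of every member. Bounds for the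
ordinary divisor function thus apply to it. -/
lemma coprimeDivisors_eq_divisors (D : ℤ) {N : ℤ} (hN : N ≠ 0) :
    ∃ m : ℕ, m ≠ 0 ∧ (m : ℤ) ∣ N ∧ IsCoprime (m : ℤ) D ∧ coprimeDivisors D N = m.divisors := by
  obtain ⟨m, hm, hmax⟩ := (coprimeDivisors D N).exists_max_image id
    ⟨1, (mem_coprimeDivisors hN).2 ⟨by simp, by simpa using isCoprime_one_left⟩⟩
  obtain ⟨hmN, hmD⟩ := (mem_coprimeDivisors hN).1 hm
  have hm0 : m ≠ 0 := by
    rintro rfl; exact hN (by simpa using hmN)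
  refine ⟨m, hm0, hmN, hmD, ?_⟩
  ext k
  rw [mem_coprimeDivisors hN, Nat.mem_divisors]
  constructor
  · rintro ⟨hkN, hkD⟩
    refine ⟨?_, hm0⟩
    have hl : Nat.lcm k m ∈ coprimeDivisors D N := by
      rw [mem_coprimeDivisors hN]
      refine ⟨?_, (hkD.mul_left hmD).of_isCoprime_of_dvd_left ?_⟩
      · rw [Int.natCast_dvd] at *
        exact Nat.lcm_dvd hkN hmN
      · exact_mod_cast Nat.lcm_dvd_mul k m
    have h1 : Nat.lcm k m ≤ m := hmax _ hl
    have h2 : Nat.lcm k m = m :=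
      le_antisymm h1 (Nat.le_of_dvd (Nat.pos_of_ne_zero fun h => by
        rw [h, mem_coprimeDivisors hN] at hl
        exact hN (by simpa using hl.1)) (Nat.dvd_lcm_right _ _))
    exact h2 ▸ Nat.dvd_lcm_left k m
  · rintro ⟨hk, -⟩
    have : (k : ℤ) ∣ m := Int.natCast_dvd_natCast.2 hk
    exact ⟨this.trans hmN, hmD.of_isCoprime_of_dvd_left this⟩

lemma card_coprimeDivisors_mul_le (D : ℤ) {e : ℕ} {N : ℤ} (he : e ≠ 0) (hN : N ≠ 0) :
    (coprimeDivisors D ((e : ℤ) * N)).card ≤ e.divisors.card * (coprimeDivisors D N).card := by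
  have he' : (e : ℤ) ≠ 0 := by exact_mod_cast he
  have hsub : coprimeDivisors D ((e : ℤ) * N) ⊆
      (e.divisors ×ˢ coprimeDivisors D N).image fun p => p.1 * p.2 := by
    intro k hk
    obtain ⟨hk1, hk2⟩ := (mem_coprimeDivisors (mul_ne_zero he' hN)).1 hk
    rw [Int.natCast_dvd, Int.natAbs_mul, Int.natAbs_natCast] at hk1
    obtain ⟨k₁, k₂, h1, h2, rfl⟩ := (Nat.dvd_mul).1 hk1
    refine Finset.mem_image.2 ⟨(k₁, k₂), Finset.mem_product.2 ⟨Nat.mem_divisors.2 ⟨h1, he⟩, ?_⟩, rfl⟩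
    refine (mem_coprimeDivisors hN).2 ⟨Int.natCast_dvd.2 h2, hk2.of_isCoprime_of_dvd_left ?_⟩
    push_cast
    exact dvd_mul_left _ _
  exact (Finset.card_le_card hsub).trans (Finset.card_image_le.trans_eq (Finset.card_product _ _))

end LevelDist

/-! ### Moments of the divisor weight over primitive vectors. -/

namespace LevelDist

variable {g : ℕ} {q : Fin g → BinForm}

/-- The integer vectors of supremum norm at most `X`. -/
noncomputable def box (X : ℕ) : Finset (ℤ × ℤ) := Finset.Icc (-(X : ℤ)) X ×ˢ Finset.Icc (-(X : ℤ)) X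

lemma mem_box {X : ℕ} {w : ℤ × ℤ} : w ∈ box X ↔ height w ≤ X := by
  simp only [box, Finset.mem_product, Finset.mem_Icc, height]
  omega

/-- The number of tuples of divisors of `q₁(v), …, q_g(v)` that are coprime to `D`. -/
noncomputable def divisorWeight (q : Fin g → BinForm) (v : ℤ × ℤ) : ℕ :=
  ∏ i, (coprimeDivisors (bigD q) ((q i).eval v)).card

/-- Trivial count row by row in w₂. It is sharp enough because it is only used for moduli n = O(X).
-/
lemma card_box_filter_dvd_le {n : ℕ} (hn : 0 < n) (A : ℤ) (X : ℕ) :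
    (((box X).filter fun w => (n : ℤ) ∣ w.1 - A * w.2).card : ℝ)
      ≤ (2 * X + 1) * ((2 * X + 1) / n + 1) := by
  have hnR : (0 : ℝ) < n := by exact_mod_cast hn
  have hcol : ∀ v : ℤ, (((Finset.Icc (-(X : ℤ)) X).filter fun u => (n : ℤ) ∣ u - v).card : ℝ)
      ≤ (2 * X + 1) / n + 1 := by
    intro v
    have h1 : ((Finset.Icc (-(X : ℤ)) X).filter fun u => (n : ℤ) ∣ u - v)
        = (Finset.Ioc (-(X : ℤ) - 1) X).filter fun u => u ≡ v [ZMOD n] := by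
      ext u
      simp only [Finset.mem_filter, Finset.mem_Icc, Finset.mem_Ioc]
      rw [Int.modEq_comm, Int.modEq_iff_dvd]
      constructor <;> rintro ⟨h, h'⟩ <;> exact ⟨by omega, h'⟩
    have h2 := Int.Ioc_filter_modEq_card (-(X : ℤ) - 1) X (by exact_mod_cast hn : (0 : ℤ) < n) v
    rw [← h1] at h2
    have h3 : (((Finset.Icc (-(X : ℤ)) X).filter fun u => (n : ℤ) ∣ u - v).card : ℝ)
        = (((max (⌊((X : ℤ) - v : ℚ) / (n : ℤ)⌋ - ⌊((-(X : ℤ) - 1 : ℤ) - v : ℚ) / (n : ℤ)⌋) 0) : ℤ) : ℝ) := by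
      rw [← h2]; push_cast; rfl
    rw [h3]
    push_cast
    refine max_le ?_ (by positivity)
    have f1 := Int.floor_le (((X : ℚ) - v) / n)
    have f2 := Int.lt_floor_add_one ((-(X : ℚ) - 1 - v) / n)
    have f3 : ((⌊((X : ℚ) - v) / n⌋ - ⌊(-(X : ℚ) - 1 - v) / n⌋ : ℤ) : ℚ) ≤ (2 * X + 1) / n + 1 := by
      have : ((X : ℚ) - v) / n - (-(X : ℚ) - 1 - v) / n = (2 * X + 1) / n := by ring
      push_cast
      linarith
    have f4 : (((⌊((X : ℚ) - v) / n⌋ - ⌊(-(X : ℚ) - 1 - v) / n⌋ : ℤ) : ℚ) : ℝ)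
        ≤ (((2 * X + 1) / n + 1 : ℚ) : ℝ) := by exact_mod_cast f3
    push_cast at f4
    exact f4
  have hsub : (box X).filter (fun w => (n : ℤ) ∣ w.1 - A * w.2) ⊆
      (Finset.Icc (-(X : ℤ)) X).biUnion fun t =>
        ((Finset.Icc (-(X : ℤ)) X).filter fun u => (n : ℤ) ∣ u - A * t).image fun u => (u, t) := by
    intro w hw
    obtain ⟨h1, h2⟩ := Finset.mem_filter.1 hw
    obtain ⟨h3, h4⟩ := Finset.mem_product.1 h1
    exact Finset.mem_biUnion.2 ⟨w.2, h4, Finset.mem_image.2 ⟨w.1, Finset.mem_filter.2 ⟨h3, h2⟩, rfl⟩⟩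
  calc (((box X).filter fun w => (n : ℤ) ∣ w.1 - A * w.2).card : ℝ)
      ≤ ∑ t ∈ Finset.Icc (-(X : ℤ)) X,
        ((((Finset.Icc (-(X : ℤ)) X).filter fun u => (n : ℤ) ∣ u - A * t).card : ℕ) : ℝ) := by
        have := (Finset.card_le_card hsub).trans (Finset.card_biUnion_le.trans
          (Finset.sum_le_sum fun t _ => Finset.card_image_le))
        exact_mod_cast this
    _ ≤ ∑ t ∈ Finset.Icc (-(X : ℤ)) X, ((2 * X + 1 : ℝ) / n + 1) :=
        Finset.sum_le_sum fun t _ => hcol _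
    _ = _ := by
        rw [Finset.sum_const, Int.card_Icc, nsmul_eq_mul]
        congr 1
        have : ((X : ℤ) + 1 - -(X : ℤ)).toNat = 2 * X + 1 := by omega
        rw [this]; push_cast; ring

/-- A primitive w lies on a line w₁ ≡ A w₂ for a root A modulo ∏ b_i. The roots number at most ∏
τ(b_i), and each lattice meets the box in O(X² / ∏ b_i) points since ∏ b_i = O(X). -/
lemma card_primitive_le {b : Fin g → ℕ} (hpos : ∀ i, 0 < b i)
    (hb : ∀ i, IsCoprime (b i : ℤ) (bigD q)) {X : ℕ} (hX : 1 ≤ X)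
    (hbX : ((∏ i, b i : ℕ) : ℝ) ≤ 4 ^ g * X) :
    ((((box X).filter fun w => Int.gcd w.1 w.2 = 1).filter
      fun w => ∀ i, (b i : ℤ) ∣ (q i).eval w).card : ℝ) ≤
      12 * 4 ^ g * X ^ 2 * ∏ i, ((b i).divisors.card : ℝ) / b i := by
  have hn : 0 < ∏ i, b i := Finset.prod_pos fun i _ => hpos i
  have hnR : (0 : ℝ) < ((∏ i, b i : ℕ) : ℝ) := by exact_mod_cast hn
  have hX1 : (1 : ℝ) ≤ X := by exact_mod_cast hX
  have hg4 : (1 : ℝ) ≤ 4 ^ g := one_le_pow₀ (by norm_num)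
  have hsub : ((box X).filter fun w => Int.gcd w.1 w.2 = 1).filter
      (fun w => ∀ i, (b i : ℤ) ∣ (q i).eval w) ⊆ (rootSet q b).biUnion fun A =>
        (box X).filter fun w => ((∏ i, b i : ℕ) : ℤ) ∣ w.1 - (A : ℤ) * w.2 := by
    intro w hw
    obtain ⟨h1, h2⟩ := Finset.mem_filter.1 hw
    obtain ⟨h3, h4⟩ := Finset.mem_filter.1 h1
    have hc := isCoprime_snd_of_gcd hpos hb h2 (by rw [h4, Nat.gcd_one_left])
    obtain ⟨A, hA, hdvd⟩ := exists_residue hn hc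
    exact Finset.mem_biUnion.2 ⟨A, mem_rootSet_of_dvd h2 hc hA hdvd, Finset.mem_filter.2 ⟨h3, hdvd⟩⟩
  have h1 : ((((box X).filter fun w => Int.gcd w.1 w.2 = 1).filter
      fun w => ∀ i, (b i : ℤ) ∣ (q i).eval w).card : ℝ) ≤ ∑ A ∈ rootSet q b,
        ((((box X).filter fun w => ((∏ i, b i : ℕ) : ℤ) ∣ w.1 - (A : ℤ) * w.2).card : ℕ) : ℝ) := by
    exact_mod_cast (Finset.card_le_card hsub).trans Finset.card_biUnion_le
  have h2 : ∀ A : ℕ,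
      ((((box X).filter fun w => ((∏ i, b i : ℕ) : ℤ) ∣ w.1 - (A : ℤ) * w.2).card : ℕ) : ℝ)
        ≤ 12 * 4 ^ g * X ^ 2 / ((∏ i, b i : ℕ) : ℝ) := by
    intro A
    refine (card_box_filter_dvd_le hn A X).trans ?_
    rw [le_div_iff₀ hnR, mul_assoc, add_mul (_ / _), div_mul_cancel₀ _ hnR.ne', one_mul]
    calc (2 * (X : ℝ) + 1) * (2 * X + 1 + ((∏ i, b i : ℕ) : ℝ))
        ≤ (3 * X) * (4 ^ g * (3 * X) + 4 ^ g * X) := by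
          gcongr
          · linarith
          · nlinarith
      _ = _ := by ring
  refine h1.trans ((Finset.sum_le_sum fun A _ => h2 A).trans ?_)
  rw [Finset.sum_const, nsmul_eq_mul, Finset.prod_div_distrib]
  have h3 : ((rootSet q b).card : ℝ) ≤ ∏ i, ((b i).divisors.card : ℝ) := by
    exact_mod_cast card_rootSet_le hpos hb
  push_cast
  rw [mul_div_assoc', mul_div_assoc']
  gcongr ?_ / _
  rw [mul_comm]
  gcongr

/-- For g ≥ 1 the choice is y = 2 X^(1/(2g)): g divisors of size y² multiply to O(X), while form
values of size X² stay below a constant times y^(4g). For g = 0 the exponent is meaningless and y =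
2 serves. -/
lemma exists_sieve_level (g : ℕ) {X : ℕ} (hX : 1 ≤ X) :
    ∃ y : ℝ, 2 ≤ y ∧ (y ^ 2) ^ g ≤ 4 ^ g * X ∧ (g ≠ 0 → (X : ℝ) ^ 2 ≤ y ^ (4 * g)) ∧
      y ^ 2 ≤ 4 * X := by
  have hX1 : (1 : ℝ) ≤ X := by exact_mod_cast hX
  rcases eq_or_ne g 0 with rfl | hg
  · exact ⟨2, le_rfl, by simpa using hX1, fun h => absurd rfl h, by linarith⟩
  have hgR : (0 : ℝ) < g := by exact_mod_cast Nat.pos_of_ne_zero hg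
  have hg1 : (1 : ℝ) ≤ g := by exact_mod_cast Nat.pos_of_ne_zero hg
  set t : ℝ := (X : ℝ) ^ ((1 : ℝ) / (2 * g)) with ht
  have ht1 : 1 ≤ t := Real.one_le_rpow hX1 (by positivity)
  have ht2g : t ^ (2 * g) = X := by
    rw [ht, ← Real.rpow_natCast, ← Real.rpow_mul (by positivity)]
    push_cast
    rw [one_div, inv_mul_cancel₀ (by positivity), Real.rpow_one]
  refine ⟨2 * t, by linarith, ?_, fun _ => ?_, ?_⟩
  · rw [← pow_mul, mul_pow, ht2g, pow_mul]; norm_num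
  · rw [mul_pow, show 4 * g = (2 * g) * 2 by ring, pow_mul, pow_mul t, ht2g]
    have : (1 : ℝ) ≤ ((2 : ℝ) ^ (2 * g)) ^ 2 := one_le_pow₀ (one_le_pow₀ (by norm_num))
    nlinarith [sq_nonneg (X : ℝ)]
  · have : t ^ 2 ≤ X := by
      rw [← ht2g]
      exact pow_le_pow_right₀ ht1 (by omega)
    nlinarith

lemma eval_abs_le (q : BinForm) {w : ℤ × ℤ} {X : ℕ} (hw : height w ≤ X) :
    (((q.eval w).natAbs : ℕ) : ℝ) ≤
      ((q.a.natAbs + 2 * q.b.natAbs + q.c.natAbs : ℕ) : ℝ) * (X : ℝ) ^ 2 := by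
  have h1 : |(w.1 : ℝ)| ≤ X := by
    rw [← Int.cast_abs, ← Nat.cast_natAbs]
    exact_mod_cast (le_max_left _ _).trans hw
  have h2 : |(w.2 : ℝ)| ≤ X := by
    rw [← Int.cast_abs, ← Nat.cast_natAbs]
    exact_mod_cast (le_max_right _ _).trans hw
  push_cast
  simp only [Nat.cast_natAbs, Int.cast_abs, BinForm.eval]
  push_cast
  calc _ ≤ |(q.a : ℝ) * w.1 ^ 2| + |2 * (q.b : ℝ) * w.1 * w.2| + |(q.c : ℝ) * w.2 ^ 2| :=
        abs_add_three _ _ _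
    _ = |(q.a : ℝ)| * (|(w.1 : ℝ)| * |(w.1 : ℝ)|) + 2 * |(q.b : ℝ)| * (|(w.1 : ℝ)| * |(w.2 : ℝ)|)
        + |(q.c : ℝ)| * (|(w.2 : ℝ)| * |(w.2 : ℝ)|) := by
        simp only [abs_mul, abs_pow, abs_two]; ring
    _ ≤ |(q.a : ℝ)| * ((X : ℝ) * X) + 2 * |(q.b : ℝ)| * ((X : ℝ) * X)
        + |(q.c : ℝ)| * ((X : ℝ) * X) := by gcongr
    _ = _ := by ring

lemma coeff_ne_zero_of_bigD (hD : bigD q ≠ 0) (i : Fin g) : (q i).a ≠ 0 ∧ (q i).c ≠ 0 :=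
  ⟨fun h => hD (by simpa [h] using a_dvd_bigD (q := q) i),
    fun h => hD (by simpa [h] using c_dvd_bigD (q := q) i)⟩

/-- The weight attached to a small divisor `m`. -/
noncomputable def sieveWeight (g c m : ℕ) : ℝ :=
  ((2 : ℝ) ^ c * (2 * (m.divisors.card : ℝ)) ^ (4 * g)) ^ 3

lemma sieveWeight_nonneg (g c m : ℕ) : 0 ≤ sieveWeight g c m := by
  unfold sieveWeight; positivity

/-- The power of τ is 12g + 1: the cube of τ^(4g) from the small-divisor bound, and one more factor
from the number of roots. -/
lemma sum_sieve_weight_le (g c : ℕ) {X : ℕ} (hX : 1 ≤ X) {y : ℝ} (hy2 : 2 ≤ y)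
    (hy4 : y ^ 2 ≤ 4 * X) :
    ∑ m ∈ Finset.Icc 1 ⌊y ^ 2⌋₊,
      sieveWeight g c m * ((m.divisors.card : ℝ) / m) ≤
      (2 ^ (c + 4 * g)) ^ 3 * (3 * (1 + Real.log X)) ^ (2 ^ (12 * g + 1)) := by
  have hX1 : (1 : ℝ) ≤ X := by exact_mod_cast hX
  have hlogX : 0 ≤ Real.log X := Real.log_nonneg hX1
  have e : ∀ m : ℕ, sieveWeight g c m * ((m.divisors.card : ℝ) / m) =
      (2 ^ (c + 4 * g)) ^ 3 * ((m.divisors.card : ℝ) ^ (12 * g + 1) / m) := by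
    intro m
    simp only [sieveWeight, mul_pow, ← pow_mul, pow_add]
    ring
  simp only [e, ← Finset.mul_sum]
  gcongr
  refine (sum_card_divisors_pow_div_le _ _).trans ?_
  have h4 : 1 ≤ ⌊y ^ 2⌋₊ := Nat.le_floor (by push_cast; nlinarith)
  have h5 : Real.log ⌊y ^ 2⌋₊ ≤ Real.log (4 * X) :=
    Real.log_le_log (by exact_mod_cast h4) ((Nat.floor_le (by positivity)).trans hy4)
  have h6 : Real.log (4 * X) ≤ 2 + Real.log X := by
    rw [Real.log_mul (by norm_num) (by positivity), show (4 : ℝ) = 2 ^ 2 by norm_num, Real.log_pow]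
    have := Real.log_two_lt_d9
    push_cast
    linarith
  have h7 : 0 ≤ Real.log (⌊y ^ 2⌋₊ : ℝ) := Real.log_nonneg (by exact_mod_cast h4)
  gcongr
  linarith

/-- A power of the divisor weight is bounded by a sum over small divisors. -/
lemma divisorWeight_pow_le (hirr : ∀ i, Irreducible (q i).toPoly) (hD : bigD q ≠ 0) {c X : ℕ}
    (hcoeff : ∀ i, (q i).a.natAbs + 2 * (q i).b.natAbs + (q i).c.natAbs ≤ c) {y : ℝ} (hy2 : 2 ≤ y)
    (hyX : g ≠ 0 → (X : ℝ) ^ 2 ≤ y ^ (4 * g)) {w : ℤ × ℤ} (hwX : height w ≤ X) (hw0 : w ≠ 0) :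
    (divisorWeight q w : ℝ) ^ 3 ≤
      ∑ b ∈ (moduli (bigD q) fun _ : Fin g => y ^ 2).filter
        (fun b => ∀ i, (b i : ℤ) ∣ (q i).eval w), ∏ i, sieveWeight g c (b i) := by
  have hex : ∀ i, ∃ b : ℕ, b ≠ 0 ∧ (b : ℤ) ∣ (q i).eval w ∧ IsCoprime (b : ℤ) (bigD q) ∧
      (b : ℝ) ≤ y ^ 2 ∧ ((coprimeDivisors (bigD q) ((q i).eval w)).card : ℝ) ≤
        2 ^ c * (2 * (b.divisors.card : ℝ)) ^ (4 * g) := by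
    intro i
    have hne := BinForm.eval_ne_zero (hirr i) (coeff_ne_zero_of_bigD hD i).1
      (coeff_ne_zero_of_bigD hD i).2 hw0
    obtain ⟨m, hm0, hmd, hmD, hme⟩ := coprimeDivisors_eq_divisors (bigD q) hne
    have hmle : (m : ℝ) ≤ 2 ^ c * y ^ (4 * g) := by
      have a1 : (m : ℝ) ≤ ((((q i).eval w).natAbs : ℕ) : ℝ) := by
        exact_mod_cast Nat.le_of_dvd (Int.natAbs_pos.2 hne) (Int.natCast_dvd.1 hmd)
      have a3 : (((q i).a.natAbs + 2 * (q i).b.natAbs + (q i).c.natAbs : ℕ) : ℝ) ≤ 2 ^ c := by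
        exact_mod_cast (hcoeff i).trans Nat.lt_two_pow_self.le
      calc (m : ℝ) ≤ _ := a1
        _ ≤ _ := eval_abs_le (q i) hwX
        _ ≤ _ := by
          gcongr
          exact hyX (Nat.pos_iff_ne_zero.1 i.pos)
    obtain ⟨b, hbm, hby, hcard⟩ := exists_small_divisor c hy2 (4 * g) hm0 hmle
    have hbm' : (b : ℤ) ∣ m := Int.natCast_dvd_natCast.2 hbm
    refine ⟨b, ne_zero_of_dvd_ne_zero hm0 hbm, hbm'.trans hmd,
      hmD.of_isCoprime_of_dvd_left hbm', hby, ?_⟩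
    rw [hme]
    exact_mod_cast hcard
  choose b hb0 hbd hbD hby hbc using hex
  have hbB : b ∈ (moduli (bigD q) fun _ : Fin g => y ^ 2).filter
      (fun b => ∀ i, (b i : ℤ) ∣ (q i).eval w) := by
    refine Finset.mem_filter.2 ⟨Finset.mem_filter.2 ⟨Fintype.mem_piFinset.2 fun i =>
      Finset.mem_Icc.2 ⟨Nat.pos_of_ne_zero (hb0 i), Nat.le_floor (hby i)⟩,
      fun i => Int.isCoprime_iff_gcd_eq_one.1 (hbD i)⟩, hbd⟩
  calc (divisorWeight q w : ℝ) ^ 3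
      = ∏ i, ((coprimeDivisors (bigD q) ((q i).eval w)).card : ℝ) ^ 3 := by
        rw [divisorWeight, Finset.prod_pow]; push_cast; rfl
    _ ≤ ∏ i, sieveWeight g c (b i) := Finset.prod_le_prod (fun i _ => by positivity) fun i _ =>
        pow_le_pow_left₀ (Nat.cast_nonneg _) (hbc i) 3
    -- The chosen tuple of small divisors is one term of a nonnegative sum over all admissible
    -- tuples, which no longer depends on a choice.
    _ ≤ _ := Finset.single_le_sum (f := fun b : Fin g → ℕ => ∏ i, sieveWeight g c (b i))
        (fun b' _ => Finset.prod_nonneg fun i _ => sieveWeight_nonneg _ _ _) hbB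

/-- Moments of the divisor weight over primitive vectors. -/
theorem sum_divisorWeight_primitive_le (hirr : ∀ i, Irreducible (q i).toPoly) (hD : bigD q ≠ 0) :
    ∃ K : ℝ, 0 ≤ K ∧ ∀ X : ℕ, 1 ≤ X →
      ∑ w ∈ (box X).filter (fun w => Int.gcd w.1 w.2 = 1), (divisorWeight q w : ℝ) ^ 3 ≤
        K * X ^ 2 * (1 + Real.log X) ^ (2 ^ (12 * g + 1) * g) := by
  set c : ℕ := ∑ i, ((q i).a.natAbs + 2 * (q i).b.natAbs + (q i).c.natAbs) with hc
  refine ⟨12 * 4 ^ g * (((2 : ℝ) ^ (c + 4 * g)) ^ 3) ^ g * 3 ^ (2 ^ (12 * g + 1) * g),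
    by positivity, fun X hX => ?_⟩
  have hX1 : (1 : ℝ) ≤ X := by exact_mod_cast hX
  have hlogX : 0 ≤ Real.log X := Real.log_nonneg hX1
  obtain ⟨y, hy2, hyg, hyX, hy4⟩ := exists_sieve_level g hX
  set P := (box X).filter fun w => Int.gcd w.1 w.2 = 1 with hP
  set B := moduli (bigD q) fun _ : Fin g => y ^ 2 with hB
  have hcount : ∀ b ∈ B, ((P.filter fun w => ∀ i, (b i : ℤ) ∣ (q i).eval w).card : ℝ) ≤
      12 * 4 ^ g * X ^ 2 * ∏ i, ((b i).divisors.card : ℝ) / b i := by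
    intro b hb
    obtain ⟨hb1, hb2⟩ := Finset.mem_filter.1 hb
    have hb1' := fun i => Finset.mem_Icc.1 (Fintype.mem_piFinset.1 hb1 i)
    refine card_primitive_le (fun i => (hb1' i).1)
      (fun i => Int.isCoprime_iff_gcd_eq_one.2 (hb2 i)) hX (le_trans ?_ hyg)
    push_cast
    calc ∏ i, (b i : ℝ) ≤ ∏ _i : Fin g, y ^ 2 := Finset.prod_le_prod (fun i _ => by positivity)
          fun i _ => (Nat.le_floor_iff (by positivity)).1 (hb1' i).2
      _ = _ := by simp
  have hsumm := sum_sieve_weight_le g c hX hy2 hy4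
  calc ∑ w ∈ P, (divisorWeight q w : ℝ) ^ 3
      ≤ ∑ w ∈ P, ∑ b ∈ B.filter (fun b => ∀ i, (b i : ℤ) ∣ (q i).eval w), ∏ i, sieveWeight g c (b i) :=
        Finset.sum_le_sum fun w hw => by
          obtain ⟨hwX, hw1⟩ := Finset.mem_filter.1 (hP ▸ hw)
          refine divisorWeight_pow_le hirr hD (fun i => ?_) hy2 hyX (mem_box.1 hwX) ?_
          · exact Finset.single_le_sum
              (f := fun i => (q i).a.natAbs + 2 * (q i).b.natAbs + (q i).c.natAbs)
              (fun _ _ => Nat.zero_le _) (Finset.mem_univ i)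
          · rintro rfl; simp at hw1
    _ = ∑ b ∈ B, ((P.filter fun w => ∀ i, (b i : ℤ) ∣ (q i).eval w).card : ℝ) * ∏ i, sieveWeight g c (b i) := by
        rw [Finset.sum_comm' (t' := B)
          (s' := fun b => P.filter fun w => ∀ i, (b i : ℤ) ∣ (q i).eval w)]
        · simp
        · intro w b; simp only [Finset.mem_filter]; tauto
    _ ≤ ∑ b ∈ B, (12 * 4 ^ g * X ^ 2 * ∏ i, ((b i).divisors.card : ℝ) / b i) * ∏ i, sieveWeight g c (b i) :=
        Finset.sum_le_sum fun b hb => mul_le_mul_of_nonneg_right (hcount b hb)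
          (Finset.prod_nonneg fun i _ => sieveWeight_nonneg _ _ _)
    _ = 12 * 4 ^ g * X ^ 2 * ∑ b ∈ B, ∏ i, (sieveWeight g c (b i) * (((b i).divisors.card : ℝ) / b i)) := by
        rw [Finset.mul_sum]
        refine Finset.sum_congr rfl fun b _ => ?_
        rw [Finset.prod_mul_distrib]; ring
    _ ≤ 12 * 4 ^ g * X ^ 2 * ∑ b ∈ Fintype.piFinset fun _ : Fin g => Finset.Icc 1 ⌊y ^ 2⌋₊,
          ∏ i, (sieveWeight g c (b i) * (((b i).divisors.card : ℝ) / b i)) := by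
        refine mul_le_mul_of_nonneg_left (Finset.sum_le_sum_of_subset_of_nonneg
          (Finset.filter_subset _ _) fun b _ _ => Finset.prod_nonneg fun i _ =>
            mul_nonneg (sieveWeight_nonneg _ _ _) (by positivity)) (by positivity)
    -- With the coprimality condition dropped, the sum over tuples factors into g identical sums.
    _ = 12 * 4 ^ g * X ^ 2 * (∑ m ∈ Finset.Icc 1 ⌊y ^ 2⌋₊, sieveWeight g c m * ((m.divisors.card : ℝ) / m)) ^ g := by
        rw [← Finset.prod_univ_sum (fun _ : Fin g => Finset.Icc 1 ⌊y ^ 2⌋₊)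
          fun _ m => sieveWeight g c m * ((m.divisors.card : ℝ) / m)]
        simp
    _ ≤ 12 * 4 ^ g * X ^ 2 *
          ((2 ^ (c + 4 * g)) ^ 3 * (3 * (1 + Real.log X)) ^ (2 ^ (12 * g + 1))) ^ g := by
        gcongr
        exact Finset.sum_nonneg fun m _ => mul_nonneg (sieveWeight_nonneg _ _ _) (by positivity)
    _ = _ := by
        rw [mul_pow, ← pow_mul (3 * (1 + Real.log X)), mul_pow 3]; ring

end LevelDist

/-! ### From primitive vectors to all nonzero vectors, with weight 1/|v|. -/

namespace LevelDist

variable {g : ℕ} {q : Fin g → BinForm}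

/-- Dyadic summation: from quadratic growth to weights `1 / |w|`. -/
lemma sum_div_height_le {F : ℤ × ℤ → ℝ} (hF : ∀ w, 0 ≤ F w) (P : ℤ × ℤ → Prop) [DecidablePred P]
    (hP : ¬ P 0) {B : ℝ} {X₀ : ℕ}
    (h : ∀ X : ℕ, 1 ≤ X → X ≤ X₀ → ∑ w ∈ (box X).filter P, F w ≤ B * X ^ 2) :
    ∀ X : ℕ, X ≤ X₀ → ∑ w ∈ (box X).filter P, F w / height w ≤ 4 * B * X := by
  intro X
  induction X using Nat.strong_induction_on with
  | _ X ih =>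
    intro hX
    rcases Nat.eq_zero_or_pos X with rfl | hXp
    · have : (box 0).filter P = ∅ := by
        refine Finset.filter_eq_empty_iff.2 fun w hw hw' => ?_
        rw [mem_box] at hw
        have hw0 : w = 0 := by
          by_contra hne
          have := height_pos hne
          omega
        exact hP (hw0 ▸ hw')
      simp [this]
    have hXR : (0 : ℝ) < X := by exact_mod_cast hXp
    have hS := h X hXp hX
    have hB : 0 ≤ B := by
      have h1 : 0 ≤ B * (X : ℝ) ^ 2 := (Finset.sum_nonneg fun w _ => hF w).trans hS
      exact nonneg_of_mul_nonneg_left h1 (by positivity)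
    have ih' := ih (X / 2) (Nat.div_lt_self hXp one_lt_two) ((Nat.div_le_self _ _).trans hX)
    have hhalf : ((X / 2 : ℕ) : ℝ) ≤ X / 2 := Nat.cast_div_le
    -- Vectors of height above X/2 contribute at most (2/X) B X² = 2BX, and the induction at X/2
    -- gives at most 2BX. The constant 4 is what makes this recursion close.
    have hpt : ∀ w ∈ (box X).filter P, F w / height w ≤
        (if w ∈ box (X / 2) then F w / height w else 0) + 2 / X * F w := by
      intro w hw
      have h1 : 0 ≤ 2 / X * F w := mul_nonneg (by positivity) (hF w)
      split_ifs with hc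
      · linarith
      · rw [mem_box, not_le] at hc
        have h2 : (X : ℝ) / 2 ≤ height w := by
          have : X ≤ 2 * height w := by omega
          have : (X : ℝ) ≤ 2 * height w := by exact_mod_cast this
          linarith
        rw [zero_add, div_eq_mul_inv, mul_comm]
        refine mul_le_mul_of_nonneg_right ?_ (hF w)
        calc ((height w : ℝ))⁻¹ ≤ ((X : ℝ) / 2)⁻¹ := inv_anti₀ (by positivity) h2
          _ = 2 / X := inv_div _ _
    calc _ ≤ _ := Finset.sum_le_sum hpt
      _ = ∑ w ∈ (box (X / 2)).filter P, F w / height w + 2 / X * ∑ w ∈ (box X).filter P, F w := by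
        rw [Finset.sum_add_distrib, ← Finset.mul_sum, ← Finset.sum_filter]
        congr 2
        ext w
        simp only [Finset.mem_filter, mem_box]
        constructor
        · rintro ⟨⟨_, h1⟩, h2⟩; exact ⟨h2, h1⟩
        · rintro ⟨h2, h1⟩; exact ⟨⟨h2.trans (Nat.div_le_self _ _), h1⟩, h2⟩
      _ ≤ 4 * B * (X / 2) + 2 / X * (B * X ^ 2) := by
        gcongr
        exact ih'.trans (by gcongr)
      _ = 4 * B * X := by field_simp; ring

lemma eval_smul (q : BinForm) (e : ℤ) (w : ℤ × ℤ) : q.eval (e • w) = e * (e * q.eval w) := by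
  simp only [BinForm.eval, Prod.smul_fst, Prod.smul_snd, smul_eq_mul]; ring

lemma height_smul (e : ℕ) (w : ℤ × ℤ) : height ((e : ℤ) • w) = e * height w := by
  simp only [height, Prod.smul_fst, Prod.smul_snd, smul_eq_mul, Int.natAbs_mul, Int.natAbs_natCast]
  exact (Nat.mul_max_mul_left _ _ _).symm ▸ rfl

/-- Since q_i(e w) = e² q_i(w), each of the g forms loses at most two factors τ(e). -/
lemma divisorWeight_smul_le (hirr : ∀ i, Irreducible (q i).toPoly) (hD : bigD q ≠ 0) {e : ℕ}
    (he : e ≠ 0) {w : ℤ × ℤ} (hw : w ≠ 0) :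
    divisorWeight q ((e : ℤ) • w) ≤ e.divisors.card ^ (2 * g) * divisorWeight q w := by
  have hpt : ∀ i, (coprimeDivisors (bigD q) ((q i).eval ((e : ℤ) • w))).card ≤
      e.divisors.card ^ 2 * (coprimeDivisors (bigD q) ((q i).eval w)).card := by
    intro i
    have hne := BinForm.eval_ne_zero (hirr i) (coeff_ne_zero_of_bigD hD i).1
      (coeff_ne_zero_of_bigD hD i).2 hw
    have he' : (e : ℤ) ≠ 0 := by exact_mod_cast he
    rw [eval_smul, sq, mul_assoc]
    exact (card_coprimeDivisors_mul_le _ he (mul_ne_zero he' hne)).trans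
      (Nat.mul_le_mul_left _ (card_coprimeDivisors_mul_le _ he hne))
  calc _ ≤ ∏ i, (e.divisors.card ^ 2 * (coprimeDivisors (bigD q) ((q i).eval w)).card) :=
        Finset.prod_le_prod' fun i _ => hpt i
    _ = _ := by
        rw [Finset.prod_mul_distrib, Finset.prod_const, Finset.card_univ, Fintype.card_fin,
          ← pow_mul]
        rfl

/-- Moments of the divisor weight over all nonzero vectors, weighted by the inverse norm. -/
theorem sum_divisorWeight_div_height_le (hirr : ∀ i, Irreducible (q i).toPoly) (hD : bigD q ≠ 0) :
    ∃ K : ℝ, 0 ≤ K ∧ ∀ X : ℕ, 1 ≤ X →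
      ∑ v ∈ (box X).filter (fun v => v ≠ 0), (divisorWeight q v : ℝ) ^ 3 / height v ≤
        K * X * (1 + Real.log X) ^ (2 ^ (12 * g + 1) * g + 2 ^ (6 * g)) := by
  obtain ⟨K, hK0, hK⟩ := sum_divisorWeight_primitive_le hirr hD
  refine ⟨4 * K, by positivity, fun X hX => ?_⟩
  have hX1 : (1 : ℝ) ≤ X := by exact_mod_cast hX
  have hlogX : 0 ≤ Real.log X := Real.log_nonneg hX1
  set L := 1 + Real.log X with hL
  set N := 2 ^ (12 * g + 1) * g with hN
  -- The logarithm is frozen at its value for the largest X, so that the growth hypothesis below X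
  -- has a constant B.
  have hprim := sum_div_height_le (F := fun w => (divisorWeight q w : ℝ) ^ 3)
    (fun w => by positivity) (fun w => Int.gcd w.1 w.2 = 1) (by simp) (B := K * L ^ N) (X₀ := X)
    (fun Y hY hYX => by
      refine (hK Y hY).trans ?_
      have h1 : Real.log Y ≤ Real.log X :=
        Real.log_le_log (by exact_mod_cast hY) (by exact_mod_cast hYX)
      have h2 : 0 ≤ Real.log Y := Real.log_nonneg (by exact_mod_cast hY)
      calc K * (Y : ℝ) ^ 2 * (1 + Real.log Y) ^ N ≤ K * (Y : ℝ) ^ 2 * L ^ N := by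
            gcongr
            linarith
        _ = _ := by ring) X le_rfl
  set P := (box X).filter fun w : ℤ × ℤ => Int.gcd w.1 w.2 = 1 with hP
  set G : ℕ × (ℤ × ℤ) → ℝ := fun p =>
    ((p.1.divisors.card : ℝ) ^ (6 * g) / p.1) * ((divisorWeight q p.2 : ℝ) ^ 3 / height p.2) with hG
  have hG0 : ∀ p, 0 ≤ G p := fun p => by positivity
  -- Writing v = e w with w primitive, the weight splits off τ(e)^(6g)/e, whose sum over e is a
  -- power of the logarithm.
  have hdec : ∀ v ∈ (box X).filter (fun v : ℤ × ℤ => v ≠ 0), ∃ p ∈ Finset.Icc 1 X ×ˢ P,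
      v = (p.1 : ℤ) • p.2 := by
    intro v hv
    obtain ⟨hvX, hv0⟩ := Finset.mem_filter.1 hv
    have hpos : 0 < Int.gcd v.1 v.2 := by
      rw [Int.gcd_pos_iff]
      by_contra! h
      exact hv0 (Prod.ext h.1 h.2)
    set w : ℤ × ℤ := (v.1 / Int.gcd v.1 v.2, v.2 / Int.gcd v.1 v.2) with hw
    have hvw : v = ((Int.gcd v.1 v.2 : ℕ) : ℤ) • w :=
      Prod.ext (Int.mul_ediv_cancel' (Int.gcd_dvd_left _ _)).symm
        (Int.mul_ediv_cancel' (Int.gcd_dvd_right _ _)).symm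
    have hgw : Int.gcd w.1 w.2 = 1 := Int.gcd_ediv_gcd_ediv_gcd hpos
    have hw0 : w ≠ 0 := by
      intro h; rw [h] at hgw; simp at hgw
    have hh : height v = Int.gcd v.1 v.2 * height w := by
      conv_lhs => rw [hvw]
      exact height_smul _ _
    rw [mem_box, hh] at hvX
    refine ⟨(Int.gcd v.1 v.2, w), Finset.mem_product.2 ⟨Finset.mem_Icc.2 ⟨hpos, ?_⟩,
      Finset.mem_filter.2 ⟨mem_box.2 ?_, hgw⟩⟩, hvw⟩
    · exact (Nat.le_mul_of_pos_right _ (height_pos hw0)).trans hvX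
    · exact (Nat.le_mul_of_pos_left _ hpos).trans hvX
  have hsub : (box X).filter (fun v : ℤ × ℤ => v ≠ 0) ⊆
      (Finset.Icc 1 X ×ˢ P).image fun p => (p.1 : ℤ) • p.2 := fun v hv => by
    obtain ⟨p, hp, rfl⟩ := hdec v hv
    exact Finset.mem_image_of_mem _ hp
  have hbound : ∀ p ∈ Finset.Icc 1 X ×ˢ P,
      (divisorWeight q ((p.1 : ℤ) • p.2) : ℝ) ^ 3 / height ((p.1 : ℤ) • p.2) ≤ G p := by
    rintro ⟨e, w⟩ hp
    obtain ⟨he, hw⟩ := Finset.mem_product.1 hp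
    have he0 : e ≠ 0 := by have := (Finset.mem_Icc.1 he).1; omega
    have hw0 : w ≠ 0 := by
      rintro rfl
      have := (Finset.mem_filter.1 hw).2
      simp at this
    have h1 : (divisorWeight q ((e : ℤ) • w) : ℝ) ≤
        (e.divisors.card : ℝ) ^ (2 * g) * divisorWeight q w := by
      exact_mod_cast divisorWeight_smul_le hirr hD he0 hw0
    simp only [hG]
    rw [height_smul, div_mul_div_comm]
    push_cast
    gcongr
    calc (divisorWeight q ((e : ℤ) • w) : ℝ) ^ 3
        ≤ ((e.divisors.card : ℝ) ^ (2 * g) * divisorWeight q w) ^ 3 := by gcongr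
      _ = _ := by rw [mul_pow, ← pow_mul]; congr 2; ring
  calc ∑ v ∈ (box X).filter (fun v => v ≠ 0), (divisorWeight q v : ℝ) ^ 3 / height v
      ≤ ∑ v ∈ (Finset.Icc 1 X ×ˢ P).image (fun p => (p.1 : ℤ) • p.2),
        (divisorWeight q v : ℝ) ^ 3 / height v :=
        Finset.sum_le_sum_of_subset_of_nonneg hsub fun v _ _ => by positivity
    _ ≤ ∑ p ∈ Finset.Icc 1 X ×ˢ P,
        (divisorWeight q ((p.1 : ℤ) • p.2) : ℝ) ^ 3 / height ((p.1 : ℤ) • p.2) :=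
        Finset.sum_image_le_of_nonneg fun p _ => by positivity
    _ ≤ ∑ p ∈ Finset.Icc 1 X ×ˢ P, G p := Finset.sum_le_sum hbound
    _ = (∑ e ∈ Finset.Icc 1 X, (e.divisors.card : ℝ) ^ (6 * g) / e) *
          ∑ w ∈ P, (divisorWeight q w : ℝ) ^ 3 / height w := by
        rw [Finset.sum_mul_sum, Finset.sum_product]
    _ ≤ L ^ (2 ^ (6 * g)) * (4 * (K * L ^ N) * X) := by
        refine mul_le_mul (sum_card_divisors_pow_div_le _ _) hprim
          (Finset.sum_nonneg fun w _ => by positivity) (by positivity)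
    _ = _ := by rw [pow_add]; ring

/-! ### Summation over the moduli and conclusion. -/

/-- The contribution of the shortest vectors. -/
lemma sum_shortVec_le (hirr : ∀ i, Irreducible (q i).toPoly) (hD : bigD q ≠ 0) {Q : Fin g → ℝ}
    {X : ℕ} (hQ : ∀ i, 0 ≤ Q i) (hX : 2 * ∏ i, Q i ≤ (X : ℝ) ^ 2) :
    ∑ d ∈ moduli (bigD q) Q, ∑ A ∈ rootSet q d,
      ((∏ i, d i).divisors.card : ℝ) / height (shortVec (∏ i, d i) A) ≤
    ∑ v ∈ (box X).filter (fun v => v ≠ 0), (divisorWeight q v : ℝ) ^ 3 / height v := by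
  set V := (box X).filter fun v : ℤ × ℤ => v ≠ 0 with hV
  set S := (moduli (bigD q) Q).sigma fun d => rootSet q d with hS
  set sv : (Σ _ : Fin g → ℕ, ℕ) → ℤ × ℤ := fun p => shortVec (∏ i, p.1 i) p.2 with hsv
  have hmod : ∀ d ∈ moduli (bigD q) Q, (∀ i, 0 < d i) ∧ (∀ i, (d i : ℝ) ≤ Q i) ∧
      ∀ i, IsCoprime (d i : ℤ) (bigD q) := by
    intro d hd
    obtain ⟨h1, h2⟩ := Finset.mem_filter.1 hd
    have h1' := fun i => Finset.mem_Icc.1 (Fintype.mem_piFinset.1 h1 i)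
    exact ⟨fun i => (h1' i).1, fun i => (Nat.le_floor_iff (hQ i)).1 (h1' i).2,
      fun i => Int.isCoprime_iff_gcd_eq_one.2 (h2 i)⟩
  have hmaps : ∀ p ∈ S, sv p ∈ V := by
    rintro ⟨d, A⟩ hp
    obtain ⟨hd, -⟩ := Finset.mem_sigma.1 hp
    obtain ⟨h1, h2, -⟩ := hmod d hd
    obtain ⟨s1, -, s3, -⟩ := shortVec_spec (Finset.prod_pos fun i _ => h1 i) (A : ℤ)
    refine Finset.mem_filter.2 ⟨mem_box.2 ?_, s1⟩
    have h3 := (height_sq_le_sqNorm _).trans s3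
    have h4 : ((∏ i, d i : ℕ) : ℝ) ≤ ∏ i, Q i := by
      push_cast
      exact Finset.prod_le_prod (fun i _ => by positivity) fun i _ => h2 i
    have h5 : ((height (shortVec (∏ i, d i) A) : ℕ) : ℝ) ^ 2 ≤ (X : ℝ) ^ 2 := by
      have h6 : ((height (shortVec (∏ i, d i) A) : ℕ) : ℝ) ^ 2 ≤ 2 * ((∏ i, d i : ℕ) : ℝ) := by
        exact_mod_cast h3
      linarith
    exact_mod_cast le_of_sq_le_sq h5 (by positivity)
  -- Many pairs (d, A) may share a shortest vector v. All have d_i ∣ q_i(v), which leaves at most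
  -- W(v) tuples d, and for each the number of roots and τ(∏ d_i) are both at most W(v).
  have hfib : ∀ v ∈ V, ∑ p ∈ S.filter (fun p => sv p = v),
      ((∏ i, p.1 i).divisors.card : ℝ) / height (sv p) ≤
        (divisorWeight q v : ℝ) ^ 3 / height v := by
    intro v hv
    have hv0 := (Finset.mem_filter.1 hv).2
    have hne := fun i => BinForm.eval_ne_zero (hirr i) (coeff_ne_zero_of_bigD hD i).1
      (coeff_ne_zero_of_bigD hD i).2 hv0
    set E := Fintype.piFinset fun i => coprimeDivisors (bigD q) ((q i).eval v) with hE
    have hsub : S.filter (fun p => sv p = v) ⊆ E.sigma fun d => rootSet q d := by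
      rintro ⟨d, A⟩ hp
      obtain ⟨hpS, hpv⟩ := Finset.mem_filter.1 hp
      obtain ⟨hd, hA⟩ := Finset.mem_sigma.1 hpS
      obtain ⟨h1, -, h3⟩ := hmod d hd
      refine Finset.mem_sigma.2 ⟨Fintype.mem_piFinset.2 fun i =>
        (mem_coprimeDivisors (hne i)).2 ⟨?_, h3 i⟩, hA⟩
      obtain ⟨-, s2, -, -⟩ := shortVec_spec (Finset.prod_pos fun i _ => h1 i) (A : ℤ)
      have hpv' : shortVec (∏ i, d i) (A : ℤ) = v := hpv
      rw [hpv'] at s2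
      have h4 := (q i).eval_sub_sq_mul_eval v A
      rw [sub_eq_iff_eq_add] at h4
      rw [h4]
      exact dvd_add (((natCast_dvd_prod d i).trans s2).mul_right _)
        (((Finset.mem_filter.1 hA).2 i).mul_left _)
    have hterm : ∀ d ∈ E, ((rootSet q d).card : ℝ) * ((∏ i, d i).divisors.card : ℝ) ≤
        (divisorWeight q v : ℝ) ^ 2 := by
      intro d hd
      have hd' := fun i => Fintype.mem_piFinset.1 hd i
      have hd'' := fun i => (mem_coprimeDivisors (hne i)).1 (hd' i)
      have hpos : ∀ i, 0 < d i := fun i => Nat.pos_of_ne_zero fun h => by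
        have := (hd'' i).1
        rw [h] at this
        exact hne i (by simpa using this)
      have hτ : ∏ i, (d i).divisors.card ≤ divisorWeight q v := by
        refine Finset.prod_le_prod' fun i _ => Finset.card_le_card ?_
        obtain ⟨m, hm0, -, -, hme⟩ := coprimeDivisors_eq_divisors (bigD q) (hne i)
        have h5 := hd' i
        rw [hme] at h5 ⊢
        exact Nat.divisors_subset_of_dvd hm0 (Nat.dvd_of_mem_divisors h5)
      have h6 := (card_rootSet_le hpos fun i => (hd'' i).2).trans hτ
      have h7 := (card_divisors_prod_le Finset.univ d).trans hτ
      rw [sq]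
      exact_mod_cast Nat.mul_le_mul h6 h7
    calc ∑ p ∈ S.filter (fun p => sv p = v), ((∏ i, p.1 i).divisors.card : ℝ) / height (sv p)
        = (∑ p ∈ S.filter (fun p => sv p = v), ((∏ i, p.1 i).divisors.card : ℝ)) / height v := by
          rw [Finset.sum_div]
          refine Finset.sum_congr rfl fun p hp => ?_
          rw [(Finset.mem_filter.1 hp).2]
      _ ≤ (∑ p ∈ E.sigma fun d => rootSet q d, ((∏ i, p.1 i).divisors.card : ℝ)) / height v := by
          refine div_le_div_of_nonneg_right (Finset.sum_le_sum_of_subset_of_nonneg hsub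
            fun p _ _ => by positivity) (by positivity)
      _ = (∑ d ∈ E, ((rootSet q d).card : ℝ) * ((∏ i, d i).divisors.card : ℝ)) / height v := by
          rw [Finset.sum_sigma]
          simp
      _ ≤ (∑ d ∈ E, (divisorWeight q v : ℝ) ^ 2) / height v :=
          div_le_div_of_nonneg_right (Finset.sum_le_sum hterm) (by positivity)
      _ = _ := by
          rw [Finset.sum_const, nsmul_eq_mul, hE, Fintype.card_piFinset]
          congr 1
          rw [show ∏ i, (coprimeDivisors (bigD q) ((q i).eval v)).card = divisorWeight q v from rfl]
          ring
  calc _ = ∑ p ∈ S, ((∏ i, p.1 i).divisors.card : ℝ) / height (sv p) := by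
        rw [hS, Finset.sum_sigma]
    _ = ∑ v ∈ V, ∑ p ∈ S.filter (fun p => sv p = v),
          ((∏ i, p.1 i).divisors.card : ℝ) / height (sv p) :=
        (Finset.sum_fiberwise_of_maps_to hmaps _).symm
    _ ≤ _ := Finset.sum_le_sum hfib

lemma one_le_prod_real {ι : Type*} (s : Finset ι) {f : ι → ℝ} (hf : ∀ i, 1 ≤ f i) :
    1 ≤ ∏ i ∈ s, f i :=
  (Finset.prod_const_one (s := s)).symm.trans_le
    (Finset.prod_le_prod (fun _ _ => zero_le_one) fun i _ => hf i)

/-- The contribution of the constant error terms. -/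
lemma sum_card_rootSet_mul_le {Q : Fin g → ℝ} (hQ : ∀ i, 1 ≤ Q i) :
    ∑ d ∈ moduli (bigD q) Q, ∑ _A ∈ rootSet q d, ((∏ i, d i).divisors.card : ℝ) ≤
      (∏ i, Q i) * (1 + Real.log (∏ i, Q i)) ^ (4 * g) := by
  have hmem : ∀ i, Q i ≤ ∏ j, Q j := fun i => by
    rw [← Finset.mul_prod_erase _ _ (Finset.mem_univ i)]
    exact le_mul_of_one_le_right (by linarith [hQ i])
      (one_le_prod_real _ hQ)
  have hpt : ∀ d ∈ moduli (bigD q) Q, ∑ _A ∈ rootSet q d, ((∏ i, d i).divisors.card : ℝ) ≤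
      ∏ i, ((d i).divisors.card : ℝ) ^ 2 := by
    intro d hd
    obtain ⟨h1, h2⟩ := Finset.mem_filter.1 hd
    have h3 := card_rootSet_le (q := q)
      (fun i => (Finset.mem_Icc.1 (Fintype.mem_piFinset.1 h1 i)).1)
      fun i => Int.isCoprime_iff_gcd_eq_one.2 (h2 i)
    rw [Finset.sum_const, nsmul_eq_mul, Finset.prod_pow, sq]
    exact_mod_cast Nat.mul_le_mul h3 (card_divisors_prod_le Finset.univ d)
  calc _ ≤ ∑ d ∈ moduli (bigD q) Q, ∏ i, ((d i).divisors.card : ℝ) ^ 2 := Finset.sum_le_sum hpt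
    _ ≤ ∑ d ∈ Fintype.piFinset fun i => Finset.Icc 1 ⌊Q i⌋₊, ∏ i, ((d i).divisors.card : ℝ) ^ 2 :=
        Finset.sum_le_sum_of_subset_of_nonneg (Finset.filter_subset _ _)
          fun d _ _ => Finset.prod_nonneg fun i _ => by positivity
    _ = ∏ i, ∑ m ∈ Finset.Icc 1 ⌊Q i⌋₊, (m.divisors.card : ℝ) ^ 2 :=
        (Finset.prod_univ_sum (fun i => Finset.Icc 1 ⌊Q i⌋₊)
          fun _ m => (m.divisors.card : ℝ) ^ 2).symm
    _ ≤ ∏ i, (Q i * (1 + Real.log (∏ i, Q i)) ^ 4) := by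
        refine Finset.prod_le_prod (fun i _ => Finset.sum_nonneg fun m _ => by positivity)
          fun i _ => (sum_card_divisors_pow_le 2 _).trans ?_
        have hfl : (⌊Q i⌋₊ : ℝ) ≤ Q i := Nat.floor_le (by linarith [hQ i])
        have hfl1 : (1 : ℝ) ≤ ⌊Q i⌋₊ := by
          exact_mod_cast Nat.le_floor (by simpa using hQ i)
        have hl : Real.log ⌊Q i⌋₊ ≤ Real.log (∏ i, Q i) :=
          Real.log_le_log (by linarith) (hfl.trans (hmem i))
        have hl0 : 0 ≤ Real.log (⌊Q i⌋₊ : ℝ) := Real.log_nonneg hfl1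
        norm_num
        gcongr
        linarith [hQ i]
    _ = _ := by
        rw [Finset.prod_mul_distrib, Finset.prod_const, Finset.card_univ, Fintype.card_fin,
          ← pow_mul]

end LevelDist

theorem mainTheorem3 (g : ℕ) :
    ∃ ν₁ ν₂ : ℝ, ∀ q : Fin g → BinForm,
      (∀ i, Irreducible (q i).toPoly) →
      (∀ i, (q i).a ≡ 1 [ZMOD 4]) →
      LevelDist.bigD q ≠ 0 →
      ∃ C : ℝ, ∀ z : ℤ × ℤ,
        (∀ i, Int.gcd ((q i).eval z) (LevelDist.bigD q) = 1) →
        ∀ (M : ℝ) (Q : Fin g → ℝ), 0 < M → (∀ i, 1 ≤ Q i) →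
          LevelDist.TStar q z M Q ≤ ENNReal.ofReal
            (C * (M * √(∏ i, Q i) * Real.log (2 * ∏ i, Q i) ^ ν₁
              + (∏ i, Q i) * Real.log (2 * ∏ i, Q i) ^ ν₂)) := by
  -- The two summands come from primitive vectors and from the extracted gcd; `4 * g` below is g
  -- times the exponent 2² of the second moment of τ. The forms affect only K.
  set N₁ : ℕ := 2 ^ (12 * g + 1) * g + 2 ^ (6 * g) with hN₁
  refine ⟨(N₁ : ℕ), (4 * g : ℕ), fun q hirr _ hD => ?_⟩
  obtain ⟨K, hK0, hK⟩ := LevelDist.sum_divisorWeight_div_height_le hirr hD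
  refine ⟨24 * K * 4 ^ N₁ + 4 ^ (4 * g), fun z _ M Q hM hQ => ?_⟩
  set P := ∏ i, Q i with hP
  have hP1 : 1 ≤ P := LevelDist.one_le_prod_real _ hQ
  have hs1 : 1 ≤ √P := Real.one_le_sqrt.2 hP1
  have hsP : √P * √P = P := Real.mul_self_sqrt (by linarith)
  set ℓ := Real.log (2 * P) with hℓ
  have hlog2 := Real.log_two_gt_d9
  have hℓ2 : Real.log 2 ≤ ℓ := Real.log_le_log two_pos (by linarith)
  have hℓ0 : 0 < ℓ := by linarith
  -- Least integer with 2P ≤ X², so the box contains every shortest vector.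
  set X : ℕ := ⌈√2 * √P⌉₊ with hX
  have h20 : (1 : ℝ) ≤ √2 := Real.one_le_sqrt.2 one_le_two
  have h2s : √2 * √2 = 2 := Real.mul_self_sqrt two_pos.le
  have h22 : √2 ≤ 2 := by nlinarith
  have hXle : (X : ℝ) ≤ 3 * √P := by
    have := Nat.ceil_lt_add_one (a := √2 * √P) (by positivity)
    nlinarith
  have hXge : √2 * √P ≤ X := Nat.le_ceil _
  have hX1 : 1 ≤ X := by
    have : (1 : ℝ) ≤ X := by nlinarith
    exact_mod_cast this
  have hX2 : 2 * P ≤ (X : ℝ) ^ 2 := by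
    calc 2 * P = (√2 * √P) ^ 2 := by rw [mul_pow, sq, sq, h2s, hsP]
      _ ≤ _ := by gcongr
  -- The 2 in log(2P) keeps ℓ ≥ log 2 > 1/2, so additive constants are absorbed even at P = 1.
  have hlogX : 1 + Real.log X ≤ 4 * ℓ := by
    have h1 : Real.log X ≤ Real.log (2 * (2 * P)) :=
      Real.log_le_log (by exact_mod_cast hX1) (by nlinarith)
    rw [Real.log_mul two_ne_zero (by positivity)] at h1
    linarith
  have hlogX0 : 0 ≤ Real.log X := Real.log_nonneg (by exact_mod_cast hX1)
  have hlogP : 1 + Real.log P ≤ 4 * ℓ := by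
    have h1 : Real.log P ≤ ℓ := Real.log_le_log (by linarith) (by linarith)
    linarith
  have hlogP0 : 0 ≤ Real.log P := Real.log_nonneg hP1
  have hbound : LevelDist.TStar q z M Q ≤ ENNReal.ofReal
      (∑ d ∈ LevelDist.moduli (LevelDist.bigD q) Q, ∑ A ∈ LevelDist.rootSet q d,
        ((∏ i, d i).divisors.card : ℝ) *
          (8 * M / LevelDist.height (LevelDist.shortVec (∏ i, d i) A) + 1)) := by
    rw [LevelDist.TStar, ENNReal.ofReal_sum_of_nonneg
      fun d _ => Finset.sum_nonneg fun A _ => by positivity]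
    refine Finset.sum_le_sum fun d hd => iSup₂_le fun R hR => ENNReal.ofReal_le_ofReal ?_
    obtain ⟨h1, h2⟩ := Finset.mem_filter.1 hd
    exact LevelDist.discrepancyStar_le hD
      (fun i => (Finset.mem_Icc.1 (Fintype.mem_piFinset.1 h1 i)).1)
      (fun i => Int.isCoprime_iff_gcd_eq_one.2 (h2 i)) z hM.le hR
  refine hbound.trans (ENNReal.ofReal_le_ofReal ?_)
  simp only [Real.rpow_natCast]
  have hsplit : ∑ d ∈ LevelDist.moduli (LevelDist.bigD q) Q, ∑ A ∈ LevelDist.rootSet q d,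
        ((∏ i, d i).divisors.card : ℝ) *
          (8 * M / LevelDist.height (LevelDist.shortVec (∏ i, d i) A) + 1) =
      8 * M * (∑ d ∈ LevelDist.moduli (LevelDist.bigD q) Q, ∑ A ∈ LevelDist.rootSet q d,
        ((∏ i, d i).divisors.card : ℝ) / LevelDist.height (LevelDist.shortVec (∏ i, d i) A)) +
      ∑ d ∈ LevelDist.moduli (LevelDist.bigD q) Q, ∑ _A ∈ LevelDist.rootSet q d,
        ((∏ i, d i).divisors.card : ℝ) := by
    simp only [Finset.mul_sum, ← Finset.sum_add_distrib]
    refine Finset.sum_congr rfl fun d _ => Finset.sum_congr rfl fun A _ => ?_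
    ring
  rw [hsplit]
  have hI := (LevelDist.sum_shortVec_le hirr hD (fun i => by linarith [hQ i]) hX2).trans (hK X hX1)
  have hII := LevelDist.sum_card_rootSet_mul_le (q := q) hQ
  have hI' : K * X * (1 + Real.log X) ^ N₁ ≤ K * (3 * √P) * (4 * ℓ) ^ N₁ := by gcongr
  have hII' : P * (1 + Real.log P) ^ (4 * g) ≤ P * (4 * ℓ) ^ (4 * g) := by gcongr
  have hA : 0 ≤ M * √P * ℓ ^ N₁ := by positivity
  have hB : 0 ≤ P * ℓ ^ (4 * g) := by positivity
  calc _ ≤ 8 * M * (K * (3 * √P) * (4 * ℓ) ^ N₁) + P * (4 * ℓ) ^ (4 * g) :=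
        add_le_add (mul_le_mul_of_nonneg_left (hI.trans hI') (by positivity)) (hII.trans hII')
    _ = 24 * K * 4 ^ N₁ * (M * √P * ℓ ^ N₁) + 4 ^ (4 * g) * (P * ℓ ^ (4 * g)) := by
        rw [mul_pow, mul_pow]; ring
    _ ≤ (24 * K * 4 ^ N₁ + 4 ^ (4 * g)) * (M * √P * ℓ ^ N₁)
          + (24 * K * 4 ^ N₁ + 4 ^ (4 * g)) * (P * ℓ ^ (4 * g)) := by
        have k1 : 0 ≤ 24 * K * (4 : ℝ) ^ N₁ := by positivity
        have k2 : (0 : ℝ) ≤ 4 ^ (4 * g) := by positivity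
        exact add_le_add (mul_le_mul_of_nonneg_right (by linarith) hA)
          (mul_le_mul_of_nonneg_right (by linarith) hB)
    _ = _ := by ring
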